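/- **Setting.** Let $k$ be a field with $\operatorname{char} k\neq 2,3$ and let $X=X_{\bar0}\cup X_{\bar1}$ be a $\mathbb Z_2$-graded set with a linear ordering $\prec$ that is a well-ordering. Let $X^*$ be the free monoid of associative words on $X$ (with empty word $1$) and $X^{\#}$ the set of nonassociative words on $X$, both with the induced parity, and let $\rho:X^\#\to X^*$ remove brackets. On $X^*$ let $<$ be the lexicographical ordering in which $u<1$ for every nonempty $u$, and let $u\ll v$ mean $l(u)<l(v)$, or $l(u)=l(v)$ and $u<v$. Nonassociative words are compared through $\rho$. A nonassociative word $u$ is a *Lyndon–Shirshov monomial* if $u\in X$, or $u=u_1u_2$ with Lyndon–Shirshov monomials $u_1>u_2$ such that, if $u_1=v_1v_2$, then $v_2\le u_2$. It is a *super-Lyndon–Shirshov monomial* if it is a Lyndon–Shirshov monomial or $u=vv$ with $v$ an odd Lyndon–Shirshov monomial; the corresponding associative words $\rho(u)$ are the (super-)Lyndon–Shirshov words. Let $\mathcal A_X$ be the free associative algebra on $X$ over $k$, with the superbracket $[x,y]=xy-(-1)^{(\deg x)(\deg y)}yx$, and let $\mathcal L_X\subset\mathcal A_X$ be the Lie subsuperalgebra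 generated by $X$ (the free Lie superalgebra); nonassociative words are read as elements of $\mathcal L_X$. For $0\ne p\in\mathcal A_X$ let $\overline p$ be the $\ll$-largest word occurring in $p$; $p$ is monic if the coefficient of $\overline p$ is $1$. Let $S\subset\mathcal L_X$ be a set of monic elements, $I$ the Lie ideal of $\mathcal L_X$ generated by $S$ (the smallest subspace containing $S$ and stable under bracketing with $\mathcal L_X$ on both sides), $J$ the two-sided ideal of $\mathcal A_X$ generated by $S$, $L=\mathcal L_X/I$ and $\mathcal U(L)=\mathcal A_X/J$. A word $u\in X^*$ is *$S$-reduced* if $u\ne a\overline sb$ for all $s\in S$, $a,b\in X^*$; a nonassociative word $u$ is $S$-reduced if $\rho(u)$ is. *Congruences.* For $w\in X^*$, $f\equiv_A 0\bmod(S,w)$ means that $f$ is a linear combination of elements $asb$ with $s\in S$, $a,b\in X^*$ and $a\overline sb\ll w$. $f\equiv_L0\bmod(S,w)$ means that $f$ is a linear combination of elements $(a(s)b)$, each obtained by putting some $s\in S$ into a marked position of a bracketed word, which are zero or have leading word $\ll w$. *Compositions.* Let $p,q\in S$. If $\overline pa=b\overline q=w$ with $l(\overline p)>l(b)$, the associative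 composition of intersection is $pa-bq$ and the Lie composition of intersection is $[w]_p-[w]_q$. If $\overline p=a\overline qb=w$, the associative composition of inclusion is $p-aqb$ and the Lie composition of inclusion is $p-[w]_q$. Here, for a word $w=a\overline pb$, a *relative bracket* $[w]_p$ is any monic scalar multiple of an element $(a(p)b)$ with leading word $w$, obtained from an arrangement of brackets on $a\,\overline p\,b$ by replacing this occurrence of $\overline p$ by $p$. If $\overline p=\overline q=zz$ with $z$ an odd Lyndon–Shirshov word and $w=zzz$, then $w$ is not a super-Lyndon–Shirshov word and no relative bracket exists; for this overlap the Lie composition is taken to be $[p,[z]]$, where $[z]$ is the Lyndon–Shirshov monomial with $\rho([z])=z$. $S$ is a *Gröbner–Shirshov basis for $J$* if every associative composition of elements of $S$, with word $w$, is $\equiv_A0\bmod(S,w)$. $S$ is a *Gröbner–Shirshov basis for $I$* if every Lie composition of elements of $S$, with word $w$ and for every choice of the relative brackets, is $\equiv_L0\bmod(S,w)$. **Proposition.** (a) If the images of the $S$-reduced words form a linear basis of $\mathcal U(L)=\mathcal A_X/J$ (distinct words having distinct images), then $S$ is a Gröbner–Shirshov basis for the ideal $J$ of $\mathcal A_X$.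 (b) If the images of the $S$-reduced super-Lyndon–Shirshov monomials form a linear basis of $L=\mathcal L_X/I$ (distinct monomials having distinct images), then $S$ is a Gröbner–Shirshov basis for the ideal $I$ of $\mathcal L_X$. -/

import Mathlib

namespace SuperGS

noncomputable section

/-! ### Words, orderings, Lyndon-Shirshov monomials -/

section Words

variable {X : Type*}

/-- The parity of an associative word over a `ℤ/2`-graded alphabet. -/
def parity (deg : X → ZMod 2) (u : FreeMonoid X) : ZMod 2 :=
  (u.toList.map deg).sum

/-- The bracket removing map from nonassociative words to associative words. -/
def rho : FreeMagma X → FreeMonoid X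
  | .of x => FreeMonoid.of x
  | .mul u v => rho u * rho v

variable [LinearOrder X]

/-- The lexicographical ordering on lists of letters; every nonempty word is smaller than
the empty word. -/
def listLexLT : List X → List X → Prop
  | [], _ => False
  | _ :: _, [] => True
  | x :: u, y :: v => x < y ∨ (x = y ∧ listLexLT u v)

/-- The lexicographical ordering `u < v` on associative words. -/
def LexLT (u v : FreeMonoid X) : Prop := listLexLT u.toList v.toList

/-- The length-lexicographical ordering `u ≪ v` on associative words. -/
def LenLexLT (u v : FreeMonoid X) : Prop :=
  u.length < v.length ∨ (u.length = v.length ∧ LexLT u v)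

/-- Lyndon-Shirshov monomials. -/
inductive IsLSMonomial : FreeMagma X → Prop
  | of (x : X) : IsLSMonomial (FreeMagma.of x)
  | mul (u w : FreeMagma X) (hu : IsLSMonomial u) (hw : IsLSMonomial w)
      (hlt : LexLT (rho w) (rho u))
      (hle : ∀ v₁ v₂ : FreeMagma X, u = v₁ * v₂ →
        LexLT (rho v₂) (rho w) ∨ rho v₂ = rho w) :
      IsLSMonomial (u * w)

/-- Super-Lyndon-Shirshov monomials: the Lyndon-Shirshov monomials, together with the squares
`v v` of the odd ones. -/
def IsSuperLSMonomial (deg : X → ZMod 2) (u : FreeMagma X) : Prop :=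
  IsLSMonomial u ∨
    ∃ v : FreeMagma X, IsLSMonomial v ∧ parity deg (rho v) = 1 ∧ u = v * v

end Words

/-! ### The free associative algebra and the free Lie superalgebra -/

section Algebra

variable (k : Type*) [Field k] {X : Type*}

/-- The superbracket on the free associative algebra `k⟨X⟩`: the bilinear map with
`[u, v] = u v - (-1) ^ (deg u * deg v) v u` on words `u`, `v`. -/
def superBracket (deg : X → ZMod 2) :
    MonoidAlgebra k (FreeMonoid X) →ₗ[k]
      MonoidAlgebra k (FreeMonoid X) →ₗ[k] MonoidAlgebra k (FreeMonoid X) :=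
  (MonoidAlgebra.basis (FreeMonoid X) k).constr k fun u =>
    (MonoidAlgebra.basis (FreeMonoid X) k).constr k fun v =>
      MonoidAlgebra.single (u * v) 1 -
        MonoidAlgebra.single (v * u) ((-1 : k) ^ ((parity deg u).val * (parity deg v).val))

/-- The free Lie superalgebra `L_X`: the subalgebra of `k⟨X⟩`, under the superbracket,
generated by the letters. -/
def freeLie (deg : X → ZMod 2) : Submodule k (MonoidAlgebra k (FreeMonoid X)) :=
  sInf {M | (∀ x : X, MonoidAlgebra.single (FreeMonoid.of x) 1 ∈ M) ∧
    ∀ p ∈ M, ∀ q ∈ M, superBracket k deg p q ∈ M}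

/-- The element of `k⟨X⟩` obtained by reading the brackets of a nonassociative word as
superbrackets. -/
def monomialEval (deg : X → ZMod 2) : FreeMagma X → MonoidAlgebra k (FreeMonoid X)
  | .of x => MonoidAlgebra.single (FreeMonoid.of x) 1
  | .mul u v => superBracket k deg (monomialEval deg u) (monomialEval deg v)

theorem monomialEval_mem (deg : X → ZMod 2) (u : FreeMagma X) :
    monomialEval k deg u ∈ freeLie k deg := by
  refine (Submodule.mem_sInf).2 fun M hM => ?_
  induction u using FreeMagma.rec with
  | of x => exact hM.1 x
  | mul u v hu hv => exact hM.2 _ hu _ hv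

/-- The Lie ideal of `L_X` generated by a subset `S` of `L_X`, as a subspace of `k⟨X⟩`: the
smallest subspace that contains `S` and is stable under bracketing with `L_X` on either side. -/
def lieIdeal (deg : X → ZMod 2) (S : Set (MonoidAlgebra k (FreeMonoid X))) :
    Submodule k (MonoidAlgebra k (FreeMonoid X)) :=
  sInf {M | S ⊆ M ∧ ∀ p ∈ M, ∀ q ∈ freeLie k deg,
    superBracket k deg p q ∈ M ∧ superBracket k deg q p ∈ M}

/-- The quotient `L = L_X / I`, where `I` is the Lie ideal generated by `S`. -/
abbrev LieQuotient (deg : X → ZMod 2) (S : Set (MonoidAlgebra k (FreeMonoid X))) :=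
  freeLie k deg ⧸ (lieIdeal k deg S).submoduleOf (freeLie k deg)

/-- The quotient `U(L) = k⟨X⟩ / J`, where `J` is the two-sided ideal generated by `S`. -/
abbrev EnvelopingQuotient (S : Set (MonoidAlgebra k (FreeMonoid X))) :=
  (TwoSidedIdeal.span S).ringCon.Quotient

/-- A family of vectors is a linear basis. -/
def IsLinearBasis {M ι : Type*} [AddCommGroup M] [Module k M] (v : ι → M) : Prop :=
  LinearIndependent k v ∧ Submodule.span k (Set.range v) = ⊤

end Algebra

/-! ### Bracketed words with a marked position -/

/-- An arrangement of brackets `(a ∗ b)` with one marked position `∗`. -/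
inductive Context (X : Type*)
  | hole : Context X
  | mulRight (C : Context X) (u : FreeMagma X) : Context X
  | mulLeft (u : FreeMagma X) (C : Context X) : Context X

namespace Context

variable {X : Type*}

/-- The associative word to the left of the marked position. -/
def left : Context X → FreeMonoid X
  | hole => 1
  | mulRight C _ => C.left
  | mulLeft u C => rho u * C.left

/-- The associative word to the right of the marked position. -/
def right : Context X → FreeMonoid X
  | hole => 1
  | mulRight C u => C.right * rho u
  | mulLeft _ C => C.right

/-- The element `(a (p) b)`: the polynomial `p` is put in the marked position and all brackets
are read as superbrackets. -/
def fill (k : Type*) [Field k] (deg : X → ZMod 2) :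
    Context X → MonoidAlgebra k (FreeMonoid X) → MonoidAlgebra k (FreeMonoid X)
  | hole, p => p
  | mulRight C u, p => superBracket k deg (C.fill k deg p) (monomialEval k deg u)
  | mulLeft u C, p => superBracket k deg (monomialEval k deg u) (C.fill k deg p)

end Context

/-! ### Leading words, reduced words, compositions -/

section Compositions

variable {k : Type*} [Field k] {X : Type*} [LinearOrder X]

/-- `w` is the leading word of `p`, the `≪`-largest word with a nonzero coefficient in `p`
(it exists, and is unique, exactly when `p ≠ 0`). -/
def IsLeadingWord (p : MonoidAlgebra k (FreeMonoid X)) (w : FreeMonoid X) : Prop :=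
  p.coeff w ≠ 0 ∧ ∀ u, p.coeff u ≠ 0 → u ≠ w → LenLexLT u w

/-- `p` is nonzero and has leading coefficient `1`. -/
def IsMonic (p : MonoidAlgebra k (FreeMonoid X)) : Prop :=
  ∃ w, IsLeadingWord p w ∧ p.coeff w = 1

/-- An associative word is `S`-reduced if it does not contain the leading word of any
element of `S`. -/
def IsReduced (S : Set (MonoidAlgebra k (FreeMonoid X))) (u : FreeMonoid X) : Prop :=
  ∀ s ∈ S, ∀ v, IsLeadingWord s v → ∀ a b : FreeMonoid X, u ≠ a * v * b

/-- `f ≡_A g mod (S, w)`. -/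
def CongrAssoc (S : Set (MonoidAlgebra k (FreeMonoid X))) (w : FreeMonoid X)
    (f g : MonoidAlgebra k (FreeMonoid X)) : Prop :=
  f - g ∈ Submodule.span k
    {h | ∃ s ∈ S, ∃ v a b : FreeMonoid X, IsLeadingWord s v ∧ LenLexLT (a * v * b) w ∧
      h = MonoidAlgebra.single a 1 * s * MonoidAlgebra.single b 1}

/-- `f ≡_L g mod (S, w)`: the difference is a linear combination of elements `(a (s) b)`, with
`s ∈ S`, all of whose words (equivalently, whose leading word if they are nonzero) are
`≪ w`. -/
def CongrLie (deg : X → ZMod 2) (S : Set (MonoidAlgebra k (FreeMonoid X)))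
    (w : FreeMonoid X) (f g : MonoidAlgebra k (FreeMonoid X)) : Prop :=
  f - g ∈ Submodule.span k
    {h | ∃ s ∈ S, ∃ C : Context X, h = C.fill k deg s ∧
      ∀ u, h.coeff u ≠ 0 → LenLexLT u w}

/-- `S` is closed under the associative composition. For `p, q ∈ S` with leading words `u, v`,
the first clause treats the compositions of intersection, the second those of inclusion. -/
def ClosedAssoc (S : Set (MonoidAlgebra k (FreeMonoid X))) : Prop :=
  ∀ p ∈ S, ∀ q ∈ S, ∀ u v : FreeMonoid X, IsLeadingWord p u → IsLeadingWord q v →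
    (∀ a b : FreeMonoid X, u * a = b * v → b.length < u.length →
      CongrAssoc S (u * a)
        (p * MonoidAlgebra.single a 1 - MonoidAlgebra.single b 1 * q) 0) ∧
    (∀ a b : FreeMonoid X, u = a * v * b →
      CongrAssoc S u
        (p - MonoidAlgebra.single a 1 * q * MonoidAlgebra.single b 1) 0)

/-- `g` is a bracket `[a v b]_p` relative to `p`, where `v` is the leading word of `p`: an
arrangement of brackets on `a v b`, in which `v` is replaced by `p`, whose value `(a (p) b)` has
leading word `a v b`, and which is made monic by a scalar. (The leading word of a nonzero
element of `L_X` is a super-Lyndon-Shirshov word, so such a `g` with `p ∈ L_X` can exist only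
for super-Lyndon-Shirshov words `a v b`.) -/
def IsRelativeBracket (deg : X → ZMod 2) (a : FreeMonoid X)
    (p : MonoidAlgebra k (FreeMonoid X)) (b : FreeMonoid X)
    (g : MonoidAlgebra k (FreeMonoid X)) : Prop :=
  ∃ (v : FreeMonoid X) (C : Context X), IsLeadingWord p v ∧ C.left = a ∧ C.right = b ∧
    IsLeadingWord (C.fill k deg p) (a * v * b) ∧
    g = ((C.fill k deg p).coeff (a * v * b))⁻¹ • C.fill k deg p

/-- `S` is closed under the Lie composition. For `p, q ∈ S` with leading words `u, v`, the first
clause treats the compositions of intersection `[w]_p - [w]_q`, the second those of inclusion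
`p - [w]_q`, for all choices of the relative brackets. The third clause completes the first
one in the only case where the overlap `w` is not a super-Lyndon-Shirshov word, and thus has
no relative brackets: if `u = v = z z` with `z` an odd Lyndon-Shirshov word and `w = z z z`, the
composition is `[p, [z]]`. -/
def ClosedLie (deg : X → ZMod 2) (S : Set (MonoidAlgebra k (FreeMonoid X))) : Prop :=
  (∀ p ∈ S, ∀ q ∈ S, ∀ u v : FreeMonoid X, IsLeadingWord p u → IsLeadingWord q v →
    (∀ a b : FreeMonoid X, u * a = b * v → b.length < u.length →
      ∀ g h, IsRelativeBracket deg 1 p a g → IsRelativeBracket deg b q 1 h →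
        CongrLie deg S (u * a) (g - h) 0) ∧
    (∀ a b : FreeMonoid X, u = a * v * b →
      ∀ h, IsRelativeBracket deg a q b h → CongrLie deg S u (p - h) 0)) ∧
  (∀ p ∈ S, ∀ m : FreeMagma X, IsLSMonomial m → parity deg (rho m) = 1 →
    IsLeadingWord p (rho m * rho m) →
      CongrLie deg S (rho m * rho m * rho m) (superBracket k deg p (monomialEval k deg m)) 0)

end Compositions

end

end SuperGS

/-! Each composition with word w lies in the ideal generated by `S`, and its terms at w cancel: it
is a difference of two monic elements with leading word w or, for zzz, a superbracket whose two top
products are equal with opposite signs. It therefore suffices that every element of the ideal whose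
words are all ≪ w is congruent to 0 mod (S, w).

Such an element can be reduced by descent along the well-ordering ≪. A leading word u ≪ w is removed
by a multiple of the reduced word (or monomial) u if u is reduced, and otherwise by a multiple of an
element built from some s ∈ S with leading word u. The latter are of the kind allowed in the
congruence and belong to the ideal. What remains is a combination of reduced elements that lies in
the ideal, and linear independence in the quotient makes it zero.

In the associative algebra the element asb serves at once. In the Lie case the descent must stay
inside the free Lie superalgebra, which needs two facts. Leading words there are
super-Lyndon-Shirshov words (`exists_isSuperLSMonomial_of_isLeadingWord`): super-Lyndon-Shirshov
monomials span (`freeLie_le_span`) and have distinct leading words, their own associative words. And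
every occurrence of the leading word of s in a super-Lyndon-Shirshov word admits a relative bracket
(`IsSuperLSMonomial.exists_context`). Squares of odd monomials acquire the leading coefficient 2,
hence the need for 2 to be invertible. -/

namespace SuperGS

open MonoidAlgebra (single)

/-! ### Cancellation and factorization in the free monoid -/

section Words

variable {X : Type*}

theorem mul_eq_mul_cases {a b u w : FreeMonoid X} (h : u * w = a * b) :
    (∃ c, a = u * c ∧ w = c * b) ∨ (∃ c, u = a * c ∧ b = c * w) :=
  List.append_eq_append_iff.1 h

theorem mul_left_length_inj {a b u w : FreeMonoid X} (h : u * w = a * b)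
    (hl : u.length = a.length) : u = a ∧ w = b :=
  List.append_inj h hl

theorem length_pos_of_ne_one {u : FreeMonoid X} (h : u ≠ 1) : 0 < u.length :=
  Nat.pos_of_ne_zero fun h' => h (FreeMonoid.length_eq_zero.1 h')

theorem freeMonoid_mul_ne_one_left {u v : FreeMonoid X} (h : u ≠ 1) : u * v ≠ 1 := by
  intro h'
  have h1 := length_pos_of_ne_one h
  have h2 := congrArg FreeMonoid.length h'
  rw [FreeMonoid.length_mul, FreeMonoid.length_one] at h2
  omega

end Words

/-! ### The lexicographical and length-lexicographical orderings -/

section WordOrder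

variable {X : Type*} [LinearOrder X]

theorem listLexLT_irrefl (u : List X) : ¬ listLexLT u u := by
  induction u with
  | nil => simp [listLexLT]
  | cons x u ih => simp [listLexLT, ih]

theorem listLexLT_trans {u v w : List X} (h₁ : listLexLT u v) (h₂ : listLexLT v w) :
    listLexLT u w := by
  induction u generalizing v w with
  | nil => exact h₁.elim
  | cons x u ih =>
    cases v with
    | nil => exact h₂.elim
    | cons y v =>
      cases w with
      | nil => trivial
      | cons z w =>
        rcases h₁ with h₁ | ⟨rfl, h₁⟩ <;> rcases h₂ with h₂ | ⟨rfl, h₂⟩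
        · exact Or.inl (h₁.trans h₂)
        · exact Or.inl h₁
        · exact Or.inl h₂
        · exact Or.inr ⟨rfl, ih h₁ h₂⟩

theorem listLexLT_trichotomy (u v : List X) : listLexLT u v ∨ u = v ∨ listLexLT v u := by
  induction u generalizing v with
  | nil => cases v <;> simp [listLexLT]
  | cons x u ih =>
    cases v with
    | nil => simp [listLexLT]
    | cons y v =>
      rcases lt_trichotomy x y with h | rfl | h
      · exact Or.inl (Or.inl h)
      · rcases ih v with h | rfl | h
        · exact Or.inl (Or.inr ⟨rfl, h⟩)
        · exact Or.inr (Or.inl rfl)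
        · exact Or.inr (Or.inr (Or.inr ⟨rfl, h⟩))
      · exact Or.inr (Or.inr (Or.inl h))

theorem listLexLT_append_left (w u v : List X) :
    listLexLT (w ++ u) (w ++ v) ↔ listLexLT u v := by
  induction w with
  | nil => rfl
  | cons x w ih => simp [listLexLT, ih]

theorem listLexLT_append_right {u v : List X} (h : listLexLT u v) (hu : ¬ v <+: u)
    (s t : List X) : listLexLT (u ++ s) (v ++ t) := by
  induction u generalizing v with
  | nil => exact h.elim
  | cons x u ih =>
    cases v with
    | nil => exact (hu List.nil_prefix).elim
    | cons y v =>
      rcases h with h | ⟨rfl, h⟩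
      · exact Or.inl h
      · exact Or.inr ⟨rfl, ih h fun h' => hu (List.cons_prefix_cons.2 ⟨rfl, h'⟩)⟩

theorem listLexLT_iff_lex {u v : List X} (h : u.length = v.length) :
    listLexLT u v ↔ List.Lex (· < ·) u v := by
  induction u generalizing v with
  | nil => cases v <;> simp_all [listLexLT]
  | cons x u ih =>
    cases v with
    | nil => simp at h
    | cons y v =>
      rw [List.cons_lex_cons_iff, ← ih (by simpa using h)]
      rfl

theorem LexLT.irrefl (u : FreeMonoid X) : ¬ LexLT u u := listLexLT_irrefl _

theorem LexLT.ne {u v : FreeMonoid X} (h : LexLT u v) : u ≠ v := by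
  rintro rfl
  exact LexLT.irrefl _ h

theorem LexLT.trans {u v w : FreeMonoid X} (h₁ : LexLT u v) (h₂ : LexLT v w) : LexLT u w :=
  listLexLT_trans h₁ h₂

theorem lexLT_trichotomy (u v : FreeMonoid X) : LexLT u v ∨ u = v ∨ LexLT v u :=
  listLexLT_trichotomy _ _

theorem lexLT_mul_left (w : FreeMonoid X) {u v : FreeMonoid X} :
    LexLT (w * u) (w * v) ↔ LexLT u v :=
  listLexLT_append_left _ _ _

theorem LexLT.mul_of_not_prefix {u v : FreeMonoid X} (h : LexLT u v)
    (hu : ∀ t, u ≠ v * t) (s t : FreeMonoid X) : LexLT (u * s) (v * t) :=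
  listLexLT_append_right h (fun ⟨r, hr⟩ => hu r hr.symm) _ _

/-- The only way right multiplication can destroy u < v is that v is a proper prefix of u; the
length bound excludes it, so the comparison is decided at a differing letter. -/
theorem LexLT.mul_of_length_le {u v : FreeMonoid X} (h : LexLT u v)
    (hl : u.length ≤ v.length) (s t : FreeMonoid X) : LexLT (u * s) (v * t) := by
  refine h.mul_of_not_prefix (fun r hr => h.ne ?_) s t
  have h1 : r.length = 0 := by
    have := congrArg FreeMonoid.length hr
    rw [FreeMonoid.length_mul] at this
    omega
  rw [FreeMonoid.length_eq_zero] at h1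
  rw [hr, h1, mul_one]

/-- `u ≤ v` in the lexicographical ordering. -/
def LexLE (u v : FreeMonoid X) : Prop := LexLT u v ∨ u = v

theorem LexLT.le {u v : FreeMonoid X} (h : LexLT u v) : LexLE u v := Or.inl h

theorem LexLE.refl (u : FreeMonoid X) : LexLE u u := Or.inr rfl

theorem LexLE.trans_lt {u v w : FreeMonoid X} (h₁ : LexLE u v) (h₂ : LexLT v w) : LexLT u w := by
  rcases h₁ with h | rfl
  exacts [h.trans h₂, h₂]

theorem LexLT.trans_le {u v w : FreeMonoid X} (h₁ : LexLT u v) (h₂ : LexLE v w) : LexLT u w := by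
  rcases h₂ with h | rfl
  exacts [h₁.trans h, h₁]

theorem LexLE.trans {u v w : FreeMonoid X} (h₁ : LexLE u v) (h₂ : LexLE v w) : LexLE u w := by
  rcases h₁ with h | rfl
  exacts [(h.trans_le h₂).le, h₂]

theorem LexLE.not_lt {u v : FreeMonoid X} (h : LexLE u v) : ¬ LexLT v u :=
  fun h' => LexLT.irrefl _ (h.trans_lt h')

theorem lexLT_or_le (u v : FreeMonoid X) : LexLT u v ∨ LexLE v u := by
  rcases lexLT_trichotomy u v with h | h | h
  exacts [Or.inl h, Or.inr (Or.inr h.symm), Or.inr (Or.inl h)]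

theorem lexLE_mul_right (u v : FreeMonoid X) : LexLE (u * v) u := by
  rcases lexLT_or_le u (u * v) with h | h
  · exfalso
    have h : LexLT (u * 1) (u * v) := by rwa [mul_one]
    rw [lexLT_mul_left] at h
    exact h
  · exact h

theorem lexLT_mul_right {u v : FreeMonoid X} (hv : v ≠ 1) : LexLT (u * v) u := by
  rcases lexLE_mul_right u v with h | h
  · exact h
  · exact (hv (by simpa using h)).elim

theorem LenLexLT.irrefl (u : FreeMonoid X) : ¬ LenLexLT u u := by
  rintro (h | h)
  exacts [lt_irrefl _ h, LexLT.irrefl _ h.2]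

theorem LenLexLT.trans {u v w : FreeMonoid X} (h₁ : LenLexLT u v) (h₂ : LenLexLT v w) :
    LenLexLT u w := by
  rcases h₁ with h₁ | ⟨h₁, h₁'⟩ <;> rcases h₂ with h₂ | ⟨h₂, h₂'⟩
  · exact Or.inl (h₁.trans h₂)
  · exact Or.inl (h₂ ▸ h₁)
  · exact Or.inl (h₁ ▸ h₂)
  · exact Or.inr ⟨h₁.trans h₂, h₁'.trans h₂'⟩

theorem lenLexLT_trichotomy (u v : FreeMonoid X) : LenLexLT u v ∨ u = v ∨ LenLexLT v u := by
  rcases lt_trichotomy u.length v.length with h | h | h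
  · exact Or.inl (Or.inl h)
  · rcases lexLT_trichotomy u v with h' | h' | h'
    exacts [Or.inl (Or.inr ⟨h, h'⟩), Or.inr (Or.inl h'), Or.inr (Or.inr (Or.inr ⟨h.symm, h'⟩))]
  · exact Or.inr (Or.inr (Or.inl h))

theorem LenLexLT.mul_left {u v : FreeMonoid X} (h : LenLexLT u v) (w : FreeMonoid X) :
    LenLexLT (w * u) (w * v) := by
  unfold LenLexLT at *
  rw [FreeMonoid.length_mul, FreeMonoid.length_mul, lexLT_mul_left]
  rcases h with h | ⟨h, h'⟩
  · left; omega
  · exact Or.inr ⟨by omega, h'⟩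

theorem LenLexLT.mul_right {u v : FreeMonoid X} (h : LenLexLT u v) (w : FreeMonoid X) :
    LenLexLT (u * w) (v * w) := by
  unfold LenLexLT
  rw [FreeMonoid.length_mul, FreeMonoid.length_mul]
  rcases h with h | ⟨h, h'⟩
  · left; omega
  · exact Or.inr ⟨by omega, h'.mul_of_length_le h.le _ _⟩

theorem LexLT.lenLexLT {u v : FreeMonoid X} (h : LexLT u v) (hl : u.length = v.length) :
    LenLexLT u v := Or.inr ⟨hl, h⟩

theorem wellFounded_lenLexLT [WellFoundedLT X] :
    WellFounded (LenLexLT : FreeMonoid X → FreeMonoid X → Prop) := by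
  refine Subrelation.wf (r := List.Shortlex (· < ·)) ?_ (List.Shortlex.wf wellFounded_lt)
  intro u v h
  rw [List.shortlex_def]
  rcases h with h | ⟨h, h'⟩
  · exact Or.inl h
  · exact Or.inr ⟨h, (listLexLT_iff_lex h).1 h'⟩

end WordOrder

/-! ### Lyndon-Shirshov words -/

section LSWords

variable {X : Type*} [LinearOrder X]

/-- A nonempty word which is greater than all its proper nonempty suffixes. -/
def IsLSWord (w : FreeMonoid X) : Prop :=
  w ≠ 1 ∧ ∀ a b : FreeMonoid X, w = a * b → a ≠ 1 → b ≠ 1 → LexLT b w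

theorem isLSWord_of (x : X) : IsLSWord (FreeMonoid.of x) := by
  refine ⟨FreeMonoid.of_ne_one x, fun a b h ha hb => ?_⟩
  have h1 := length_pos_of_ne_one ha
  have h2 := length_pos_of_ne_one hb
  have h3 := congrArg FreeMonoid.length h
  rw [FreeMonoid.length_mul, FreeMonoid.length_of] at h3
  omega

theorem IsLSWord.suffix_le {a b : FreeMonoid X} (h : IsLSWord (a * b)) (hb : b ≠ 1) :
    LexLE b (a * b) := by
  by_cases ha : a = 1
  · subst ha; right; rw [one_mul]
  · exact (h.2 a b rfl ha hb).le

/-- A proper suffix of xy is either a suffix of y, hence at most y < xy, or cy with c a proper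
suffix of x; then c < x is decided within c, because c is shorter. -/
theorem IsLSWord.mul {x y : FreeMonoid X} (hx : IsLSWord x) (hy : IsLSWord y)
    (h : LexLT y x) : IsLSWord (x * y) := by
  have key : LexLT y (x * y) := by
    -- If y = xt, then t < y since y is Lyndon-Shirshov, and x can be prepended to both sides.
    -- Otherwise y < x is decided at a letter and survives multiplying x by y.
    by_cases hp : ∃ t, y = x * t
    · obtain ⟨t, rfl⟩ := hp
      have ht : t ≠ 1 := by
        rintro rfl
        rw [mul_one] at h
        exact LexLT.irrefl _ h
      rw [lexLT_mul_left]
      exact hy.2 x t rfl hx.1 ht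
    · have := h.mul_of_not_prefix (fun t ht => hp ⟨t, ht⟩) 1 y
      rwa [mul_one] at this
  refine ⟨freeMonoid_mul_ne_one_left hx.1, fun a b hab ha hb => ?_⟩
  rcases mul_eq_mul_cases hab with ⟨c, rfl, rfl⟩ | ⟨c, rfl, rfl⟩
  · exact (hy.suffix_le hb).trans_lt key
  · by_cases hc : c = 1
    · subst hc
      rwa [one_mul]
    · have h1 := hx.2 a c rfl ha hc
      refine h1.mul_of_length_le ?_ y y
      rw [FreeMonoid.length_mul]
      omega

theorem IsLSWord.rotate {a b : FreeMonoid X} (h : IsLSWord (a * b)) (ha : a ≠ 1) (hb : b ≠ 1) :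
    LexLT (b * a) (a * b) := by
  have := (h.2 a b rfl ha hb).mul_of_length_le (by rw [FreeMonoid.length_mul]; omega) a 1
  rwa [mul_one] at this

/-- Two overlapping Lyndon-Shirshov words merge: suffixes starting in qb are at most qb < pqb, and
those starting earlier are compared within pq. -/
theorem IsLSWord.overlap {p q b : FreeMonoid X} (h₁ : IsLSWord (p * q)) (h₂ : IsLSWord (q * b))
    (hp : p ≠ 1) (hq : q ≠ 1) : IsLSWord (p * q * b) := by
  have key : LexLT (q * b) (p * q * b) :=
    (h₁.2 p q rfl hp hq).mul_of_length_le (by rw [FreeMonoid.length_mul]; omega) b b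
  refine ⟨freeMonoid_mul_ne_one_left h₁.1, fun a c hac ha hc => ?_⟩
  rw [mul_assoc] at hac
  rcases mul_eq_mul_cases hac with ⟨d, rfl, hd⟩ | ⟨d, rfl, rfl⟩
  · refine LexLE.trans_lt ?_ key
    rw [hd] at h₂ ⊢
    exact h₂.suffix_le hc
  · have hdq : d * q ≠ 1 := by
      intro h
      have h1 := length_pos_of_ne_one hq
      have h2 := congrArg FreeMonoid.length h
      rw [FreeMonoid.length_mul, FreeMonoid.length_one] at h2
      omega
    have := (h₁.2 a (d * q) (mul_assoc _ _ _) ha hdq).mul_of_length_le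
      (by simp only [FreeMonoid.length_mul]; omega) b b
    rwa [mul_assoc d q b] at this

/-- The suffix of a Lyndon-Shirshov word does not agree with a prefix of it. -/
theorem IsLSWord.not_mul_of_suffix_prefix {y a p q b : FreeMonoid X} (hy : IsLSWord y)
    (h₁ : y = a * p) (h₂ : y = q * b) (hp : p ≠ 1) (hq : q ≠ 1) : ¬ IsLSWord (p * q) := by
  intro h
  have h1 : LexLT q (p * q) := h.2 p q rfl hp hq
  have h2 : LexLE p y := by
    subst h₁
    exact hy.suffix_le hp
  have h3 : LexLE y q := by
    rw [h₂]
    exact lexLE_mul_right q b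
  exact LexLT.irrefl _ (((h3.trans_lt h1).trans_le (lexLE_mul_right p q)).trans_le h2)

/-- A square of a Lyndon-Shirshov word is not a Lyndon-Shirshov word. -/
theorem not_isLSWord_mul_self {z : FreeMonoid X} : ¬ IsLSWord (z * z) := by
  intro h
  have hz : z ≠ 1 := by
    rintro rfl
    exact h.1 (one_mul 1)
  exact LexLT.irrefl _ (h.rotate hz hz)

end LSWords

/-! ### Bracketings of Lyndon-Shirshov words and their uniqueness -/

section LSMonomials

variable {X : Type*}

theorem freeMagma_mul_inj {a b c d : FreeMagma X} (h : a * b = c * d) : a = c ∧ b = d := by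
  cases h
  exact ⟨rfl, rfl⟩

theorem rho_mul (u v : FreeMagma X) : rho (u * v) = rho u * rho v := rfl

theorem rho_ne_one (u : FreeMagma X) : rho u ≠ 1 := by
  induction u using FreeMagma.rec with
  | of x => exact FreeMonoid.of_ne_one x
  | mul u v hu hv => exact freeMonoid_mul_ne_one_left hu

theorem eq_one_of_of_eq_mul {x : X} {p c : FreeMonoid X} (h : FreeMonoid.of x = p * c)
    (hp : p ≠ 1) : c = 1 := by
  have h1 := length_pos_of_ne_one hp
  have h3 := congrArg FreeMonoid.length h
  rw [FreeMonoid.length_mul, FreeMonoid.length_of] at h3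
  rw [← FreeMonoid.length_eq_zero]
  omega

theorem mul_self_inj {u v : FreeMonoid X} (h : u * u = v * v) : u = v := by
  refine (mul_left_length_inj h ?_).1
  have := congrArg FreeMonoid.length h
  rw [FreeMonoid.length_mul, FreeMonoid.length_mul] at this
  omega

variable [LinearOrder X]

theorem IsLSMonomial.isLSWord {m : FreeMagma X} (h : IsLSMonomial m) : IsLSWord (rho m) := by
  induction h with
  | of x => exact isLSWord_of x
  | mul u w _ _ hlt _ hu hw => exact hu.mul hw hlt

/-- A list of Lyndon-Shirshov monomials with nondecreasing associative words. -/
def IsLSList (L : List (FreeMagma X)) : Prop :=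
  (∀ m ∈ L, IsLSMonomial m) ∧ L.Pairwise fun m n => LexLE (rho m) (rho n)

theorem IsLSList.of_cons {m : FreeMagma X} {L : List (FreeMagma X)} (h : IsLSList (m :: L)) :
    IsLSList L :=
  ⟨fun n hn => h.1 n (List.mem_cons_of_mem _ hn), (List.pairwise_cons.1 h.2).2⟩

/-- Multiply m by the head of the list as long as the head is smaller. The hypothesis on second
factors is exactly what makes each product a Lyndon-Shirshov monomial, and it persists because the
list is nondecreasing. -/
theorem IsLSList.exists_insert {m : FreeMagma X} (hm : IsLSMonomial m) {L : List (FreeMagma X)}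
    (hL : IsLSList L)
    (h : ∀ v₁ v₂, m = v₁ * v₂ → ∀ n ∈ L, LexLE (rho v₂) (rho n)) :
    ∃ L', IsLSList L' ∧ (L'.map rho).prod = rho m * (L.map rho).prod := by
  induction L generalizing m with
  | nil => exact ⟨[m], ⟨by simpa using hm, by simp⟩, by simp⟩
  | cons c L ih =>
    rcases lexLT_or_le (rho c) (rho m) with hc | hc
    · have hmc : IsLSMonomial (m * c) :=
        .mul m c hm (hL.1 c (by simp)) hc fun v₁ v₂ hv => h v₁ v₂ hv c (by simp)
      obtain ⟨L', h1, h2⟩ := ih hmc hL.of_cons (by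
        intro v₁ v₂ hv n hn
        obtain ⟨-, rfl⟩ : m = v₁ ∧ c = v₂ := freeMagma_mul_inj hv
        exact (List.pairwise_cons.1 hL.2).1 n hn)
      exact ⟨L', h1, by rw [h2, rho_mul, List.map_cons, List.prod_cons, mul_assoc]⟩
    · refine ⟨m :: c :: L, ⟨?_, ?_⟩, by simp⟩
      · rintro n (_ | ⟨_, hn⟩)
        exacts [hm, hL.1 n hn]
      · rw [List.pairwise_cons]
        refine ⟨?_, hL.2⟩
        rintro n (_ | ⟨_, hn⟩)
        exacts [hc, hc.trans ((List.pairwise_cons.1 hL.2).1 n hn)]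

/-- Every word is a product of a nondecreasing sequence of Lyndon-Shirshov words. -/
theorem exists_isLSList (w : FreeMonoid X) :
    ∃ L : List (FreeMagma X), IsLSList L ∧ (L.map rho).prod = w := by
  induction w using FreeMonoid.inductionOn' with
  | one => exact ⟨[], ⟨by simp, by simp⟩, by simp⟩
  | of_mul x w ih =>
    obtain ⟨L, hL, rfl⟩ := ih
    refine hL.exists_insert (.of x) fun v₁ v₂ hv => ?_
    simp at hv

/-- In a factorization of a word `t` such that `t * r` is a Lyndon-Shirshov word, the last
factor is greater than `r`. -/
theorem IsLSList.lt_last {L : List (FreeMagma X)} {d : FreeMagma X} (hL : IsLSList (L ++ [d]))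
    {r : FreeMonoid X} (hr : r ≠ 1) (h : IsLSWord (((L ++ [d]).map rho).prod * r)) :
    LexLT r (rho d) := by
  cases L with
  | nil =>
    simp only [List.nil_append, List.map_cons, List.map_nil, List.prod_cons, List.prod_nil,
      mul_one] at h
    exact (h.2 _ _ rfl (rho_ne_one d) hr).trans_le (lexLE_mul_right _ _)
  | cons c L =>
    simp only [List.cons_append, List.map_cons, List.prod_cons] at h
    have h1 := h.2 _ _ rfl (freeMonoid_mul_ne_one_left (rho_ne_one c)) hr
    rw [mul_assoc] at h1
    exact (h1.trans_le (lexLE_mul_right _ _)).trans_le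
      ((List.pairwise_cons.1 hL.2).1 d (by simp))

/-- The second factor of a Lyndon-Shirshov monomial is its longest proper Lyndon-Shirshov
suffix. -/
theorem IsLSMonomial.exists_suffix {u w : FreeMagma X} (h : IsLSMonomial (u * w))
    {p r : FreeMonoid X} (hpr : rho (u * w) = p * r) (hp : p ≠ 1) (hr : IsLSWord r) :
    ∃ t, rho w = t * r := by
  suffices H : ∀ m : FreeMagma X, IsLSMonomial m → ∀ u w, m = u * w → ∀ p r, rho m = p * r →
      p ≠ 1 → IsLSWord r → ∃ t, rho w = t * r from H _ h _ _ rfl _ _ hpr hp hr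
  clear h hpr hp hr u w p r
  intro m hm
  induction hm with
  | of x => intro u w h; simp at h
  | mul u w hu hw hlt hle ihu ihw =>
    intro u' w' h p r hpr hp hr
    obtain ⟨rfl, rfl⟩ : u = u' ∧ w = w' := freeMagma_mul_inj h
    rw [rho_mul] at hpr
    rcases mul_eq_mul_cases hpr with ⟨c, -, hc⟩ | ⟨c, hc, rfl⟩
    · exact ⟨c, hc⟩
    by_cases hc1 : c = 1
    · exact ⟨1, by rw [hc1, one_mul, one_mul]⟩
    exfalso
    -- Here r = c·w with c a nonempty suffix of u. The last Lyndon-Shirshov factor d of c exceeds w,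
    -- while by induction d is a suffix of the second factor v₂ of u, so d ≤ v₂ ≤ w.
    obtain ⟨L, hL, rfl⟩ := exists_isLSList c
    rcases List.eq_nil_or_concat L with rfl | ⟨L, d, rfl⟩
    · exact hc1 (by simp)
    rw [List.concat_eq_append] at *
    have h1 := hL.lt_last (rho_ne_one w) hr
    cases hu with
    | of x => exact hc1 (eq_one_of_of_eq_mul hc hp)
    | mul v₁ v₂ hv₁ hv₂ _ _ =>
      obtain ⟨t, ht⟩ := ihu v₁ v₂ rfl (p * (L.map rho).prod) (rho d) (by
        rw [hc]; simp [mul_assoc]) (freeMonoid_mul_ne_one_left hp) (hL.1 d (by simp)).isLSWord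
      have h2 : LexLE (rho d) (rho v₂) := by
        have := hv₂.isLSWord
        rw [ht] at this ⊢
        exact this.suffix_le (rho_ne_one d)
      exact (h2.trans (hle v₁ v₂ rfl)).not_lt h1

/-- The second factor is determined by the word as its longest proper Lyndon-Shirshov suffix, so the
bracketing is determined recursively. -/
theorem IsLSMonomial.ext {m n : FreeMagma X} (hm : IsLSMonomial m) (hn : IsLSMonomial n)
    (h : rho m = rho n) : m = n := by
  induction hm generalizing n with
  | of x =>
    cases hn with
    | of y => rw [FreeMonoid.of_injective h]
    | mul u w _ _ _ _ =>
      exact (rho_ne_one w (eq_one_of_of_eq_mul h (rho_ne_one u))).elim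
  | mul u w hu hw hlt hle ihu ihw =>
    have hm : IsLSMonomial (u * w) := .mul u w hu hw hlt hle
    cases hn with
    | of y =>
      exact (rho_ne_one w (eq_one_of_of_eq_mul h.symm (rho_ne_one u))).elim
    | mul u' w' hu' hw' hlt' hle' =>
      have hn : IsLSMonomial (u' * w') := .mul u' w' hu' hw' hlt' hle'
      obtain ⟨t, ht⟩ := hm.exists_suffix h (rho_ne_one u') hw'.isLSWord
      obtain ⟨t', ht'⟩ := hn.exists_suffix h.symm (rho_ne_one u) hw.isLSWord
      have h1 := congrArg FreeMonoid.length ht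
      have h2 := congrArg FreeMonoid.length ht'
      rw [FreeMonoid.length_mul] at h1 h2
      have h3 : t = 1 := FreeMonoid.length_eq_zero.1 (by omega)
      have hw' : rho w = rho w' := by rw [ht, h3, one_mul]
      have hu' : rho u = rho u' := by
        rw [rho_mul, rho_mul, hw'] at h
        exact mul_right_cancel h
      rw [ihu ‹_› hu', ihw ‹_› hw']

theorem IsSuperLSMonomial.ext {deg : X → ZMod 2} {m n : FreeMagma X}
    (hm : IsSuperLSMonomial deg m) (hn : IsSuperLSMonomial deg n) (h : rho m = rho n) :
    m = n := by
  rcases hm with hm | ⟨m, hm, -, rfl⟩ <;> rcases hn with hn | ⟨n, hn, -, rfl⟩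
  · exact hm.ext hn h
  · have := hm.isLSWord
    rw [h] at this
    exact (not_isLSWord_mul_self this).elim
  · have := hn.isLSWord
    rw [← h] at this
    exact (not_isLSWord_mul_self this).elim
  · rw [hm.ext hn (mul_self_inj h)]

end LSMonomials

/-! ### Supports, parity and multidegree of superbrackets -/

section Support

variable {k : Type*} [Field k] {X : Type*}

variable (k) in
/-- The subspace of elements all of whose words lie in `P`. -/
def supportedOn (P : Set (FreeMonoid X)) : Submodule k (MonoidAlgebra k (FreeMonoid X)) where
  carrier := {f | ∀ u, f.coeff u ≠ 0 → u ∈ P}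
  zero_mem' := by simp
  add_mem' := by
    intro f g hf hg u hu
    by_cases h : f.coeff u = 0
    · refine hg u fun h' => hu ?_
      simp [h, h']
    · exact hf u h
  smul_mem' := by
    intro c f hf u hu
    refine hf u fun h => hu ?_
    simp [h]

theorem supportedOn_mono {P Q : Set (FreeMonoid X)} (h : P ⊆ Q) :
    supportedOn k P ≤ supportedOn k Q := fun _ hf u hu => h (hf u hu)

theorem single_mem_supportedOn {P : Set (FreeMonoid X)} {u : FreeMonoid X} (hu : u ∈ P) (c : k) :
    single u c ∈ supportedOn k P := by
  classical
  intro v hv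
  rw [MonoidAlgebra.coeff_single, Finsupp.single_apply] at hv
  split_ifs at hv with h
  · exact h ▸ hu
  · exact (hv rfl).elim

theorem supportedOn_induction {P : Set (FreeMonoid X)} {f : MonoidAlgebra k (FreeMonoid X)}
    (hf : f ∈ supportedOn k P) {p : MonoidAlgebra k (FreeMonoid X) → Prop} (zero : p 0)
    (add : ∀ f g, p f → p g → p (f + g)) (single : ∀ u ∈ P, ∀ c, p (single u c)) : p f := by
  rw [← MonoidAlgebra.sum_coeff_single f]
  exact Finset.sum_induction _ p add zero fun u hu =>
    single u (hf u (by simpa using hu)) _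

theorem superBracket_single (deg : X → ZMod 2) (u v : FreeMonoid X) (a b : k) :
    superBracket k deg (single u a) (single v b) =
      single (u * v) (a * b) -
        single (v * u) (a * b * (-1) ^ ((parity deg u).val * (parity deg v).val)) := by
  have hu : single u a = a • MonoidAlgebra.basis (FreeMonoid X) k u := by simp
  have hv : single v b = b • MonoidAlgebra.basis (FreeMonoid X) k v := by simp
  rw [hu, hv, superBracket, map_smul, map_smul, LinearMap.smul_apply, Module.Basis.constr_basis,
    Module.Basis.constr_basis]
  simp [smul_sub, mul_assoc, mul_left_comm, mul_comm]

theorem superBracket_mem_supportedOn (deg : X → ZMod 2) {P Q R : Set (FreeMonoid X)}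
    (h : ∀ u ∈ P, ∀ v ∈ Q, u * v ∈ R ∧ v * u ∈ R) {f g : MonoidAlgebra k (FreeMonoid X)}
    (hf : f ∈ supportedOn k P) (hg : g ∈ supportedOn k Q) :
    superBracket k deg f g ∈ supportedOn k R := by
  refine supportedOn_induction hf
    (p := fun f => superBracket k deg f g ∈ supportedOn k R) ?_
    (fun f₁ f₂ h₁ h₂ => ?_) fun u hu a => ?_
  · simp
  · rw [map_add, LinearMap.add_apply]
    exact add_mem h₁ h₂
  refine supportedOn_induction hg
    (p := fun g => superBracket k deg (single u a) g ∈ supportedOn k R) ?_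
    (fun f₁ f₂ h₁ h₂ => ?_) fun v hv b => ?_
  · simp
  · rw [map_add]
    exact add_mem h₁ h₂
  rw [superBracket_single]
  exact sub_mem (single_mem_supportedOn (h u hu v hv).1 _)
    (single_mem_supportedOn (h u hu v hv).2 _)

/-- For parity-homogeneous elements the sign is constant, so identities for brackets become
identities in an associative ring. -/
theorem superBracket_eq (deg : X → ZMod 2) {i j : ZMod 2} {f g : MonoidAlgebra k (FreeMonoid X)}
    (hf : f ∈ supportedOn k {u | parity deg u = i}) (hg : g ∈ supportedOn k {u | parity deg u = j}) :
    superBracket k deg f g = f * g - (-1 : k) ^ (i.val * j.val) • (g * f) := by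
  refine supportedOn_induction hf (p := fun f =>
    superBracket k deg f g = f * g - (-1 : k) ^ (i.val * j.val) • (g * f)) ?_
    (fun f₁ f₂ h₁ h₂ => ?_) fun u hu a => ?_
  · simp
  · rw [map_add, LinearMap.add_apply, h₁, h₂, add_mul, mul_add, smul_add]
    abel
  refine supportedOn_induction hg (p := fun g => superBracket k deg (single u a) g =
    single u a * g - (-1 : k) ^ (i.val * j.val) • (g * single u a)) ?_
    (fun f₁ f₂ h₁ h₂ => ?_) fun v hv b => ?_
  · simp
  · rw [map_add, h₁, h₂, add_mul, mul_add, smul_add]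
    abel
  rw [superBracket_single, MonoidAlgebra.single_mul_single, MonoidAlgebra.single_mul_single,
    MonoidAlgebra.smul_single, hu, hv, smul_eq_mul, mul_comm b a, mul_comm (_ ^ _)]

theorem parity_mul (deg : X → ZMod 2) (u v : FreeMonoid X) :
    parity deg (u * v) = parity deg u + parity deg v := by
  simp [parity]

/-- The number of occurrences of each letter in a word. -/
def content (u : FreeMonoid X) : Multiset X := (u.toList : Multiset X)

theorem content_mul (u v : FreeMonoid X) : content (u * v) = content u + content v := by
  simp [content]

theorem parity_eq_of_content_eq (deg : X → ZMod 2) {u v : FreeMonoid X}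
    (h : content u = content v) : parity deg u = parity deg v := by
  have : ∀ u : FreeMonoid X, parity deg u = ((content u).map deg).sum := by
    intro u
    simp [parity, content]
  rw [this, this, h]

theorem monomialEval_mul (deg : X → ZMod 2) (u v : FreeMagma X) :
    monomialEval k deg (u * v) =
      superBracket k deg (monomialEval k deg u) (monomialEval k deg v) := rfl

theorem monomialEval_mem_supportedOn (deg : X → ZMod 2) (m : FreeMagma X) :
    monomialEval k deg m ∈ supportedOn k {u | content u = content (rho m)} := by
  induction m using FreeMagma.rec with
  | of x =>
    exact single_mem_supportedOn (k := k) (P := {u | content u = content (FreeMonoid.of x)}) rfl 1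
  | mul u v hu hv =>
    refine superBracket_mem_supportedOn deg ?_ hu hv
    intro a (ha : content a = _) b (hb : content b = _)
    refine ⟨?_, ?_⟩
    · change content _ = content (rho u * rho v)
      rw [content_mul, content_mul, ha, hb]
    · change content _ = content (rho u * rho v)
      rw [content_mul, content_mul, ha, hb, add_comm]

theorem monomialEval_mem_parity (deg : X → ZMod 2) (m : FreeMagma X) :
    monomialEval k deg m ∈ supportedOn k {u | parity deg u = parity deg (rho m)} :=
  supportedOn_mono (fun _ hu => parity_eq_of_content_eq deg hu)
    (monomialEval_mem_supportedOn deg m)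

end Support

/-! ### Leading words of superbrackets -/

section Leading

variable {k : Type*} [Field k] {X : Type*} [LinearOrder X]

theorem IsLeadingWord.unique {f : MonoidAlgebra k (FreeMonoid X)} {u v : FreeMonoid X}
    (hu : IsLeadingWord f u) (hv : IsLeadingWord f v) : u = v := by
  by_contra h
  exact LenLexLT.irrefl _ ((hu.2 v hv.1 fun h' => h h'.symm).trans (hv.2 u hu.1 h))

theorem IsMonic.coeff_eq_one {f : MonoidAlgebra k (FreeMonoid X)} (hf : IsMonic f)
    {w : FreeMonoid X} (hw : IsLeadingWord f w) : f.coeff w = 1 := by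
  obtain ⟨v, hv, h⟩ := hf
  rwa [hw.unique hv]

theorem IsLeadingWord.sub_single_mem {f : MonoidAlgebra k (FreeMonoid X)} {w : FreeMonoid X}
    (h : IsLeadingWord f w) :
    f - single w (f.coeff w) ∈ supportedOn k {u | LenLexLT u w} := by
  classical
  intro u hu
  by_cases huw : u = w
  · subst huw
    simp at hu
  · refine h.2 u (fun h' => hu ?_) huw
    simp [Ne.symm huw, h']

theorem isLeadingWord_of_sub_single_mem {f : MonoidAlgebra k (FreeMonoid X)} {w : FreeMonoid X}
    {c : k} (hc : c ≠ 0) (h : f - single w c ∈ supportedOn k {u | LenLexLT u w}) :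
    IsLeadingWord f w ∧ f.coeff w = c := by
  classical
  have h1 : f.coeff w = c := by
    by_contra hne
    refine LenLexLT.irrefl w (h w ?_)
    simpa [sub_eq_zero] using hne
  refine ⟨⟨h1 ▸ hc, fun u hu huw => h u ?_⟩, h1⟩
  simpa [Finsupp.single_apply, Ne.symm huw] using hu

theorem IsLeadingWord.smul {f : MonoidAlgebra k (FreeMonoid X)} {w : FreeMonoid X}
    (h : IsLeadingWord f w) {c : k} (hc : c ≠ 0) : IsLeadingWord (c • f) w := by
  refine ⟨by simpa using ⟨hc, h.1⟩, fun u hu => h.2 u fun h' => hu ?_⟩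
  simp [h']

/-- The difference of two elements with the same leading word and the same leading
coefficient only has smaller words. -/
theorem IsLeadingWord.sub_mem_supportedOn {f g : MonoidAlgebra k (FreeMonoid X)} {w : FreeMonoid X}
    (hf : IsLeadingWord f w) (hg : IsLeadingWord g w) (h : f.coeff w = g.coeff w) :
    f - g ∈ supportedOn k {u | LenLexLT u w} := by
  have := sub_mem hf.sub_single_mem hg.sub_single_mem
  rwa [h, sub_sub_sub_cancel_right] at this

theorem exists_lenLexLT_max {s : Finset (FreeMonoid X)} (hs : s.Nonempty) :
    ∃ w ∈ s, ∀ u ∈ s, u ≠ w → LenLexLT u w := by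
  induction hs using Finset.Nonempty.cons_induction with
  | singleton a => exact ⟨a, by simp, by simp +contextual⟩
  | cons a s h hs ih =>
    obtain ⟨w, hw, hmax⟩ := ih
    rcases lenLexLT_trichotomy a w with h' | rfl | h'
    · refine ⟨w, Finset.mem_cons_of_mem hw, fun u hu huw => ?_⟩
      rcases Finset.mem_cons.1 hu with rfl | hu
      exacts [h', hmax u hu huw]
    · exact (h hw).elim
    · refine ⟨a, Finset.mem_cons_self a s, fun u hu hua => ?_⟩
      have hu := (Finset.mem_cons.1 hu).resolve_left hua
      by_cases huw : u = w
      exacts [huw ▸ h', (hmax u hu huw).trans h']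

theorem exists_isLeadingWord {f : MonoidAlgebra k (FreeMonoid X)} (hf : f ≠ 0) :
    ∃ w, IsLeadingWord f w := by
  have hne : f.coeff.support.Nonempty := by
    rw [Finsupp.support_nonempty_iff]
    simpa using hf
  obtain ⟨w, hw, hmax⟩ := exists_lenLexLT_max hne
  exact ⟨w, by simpa using hw, fun u hu => hmax u (by simpa using hu)⟩

/-- Only the product of the leading terms, in either order, can reach wv. The weak inequality is
needed: it covers commuting words, that is, squares and the overlap zzz. -/
theorem superBracket_sub_single_mem (deg : X → ZMod 2) {f g : MonoidAlgebra k (FreeMonoid X)}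
    {w v : FreeMonoid X} (hf : IsLeadingWord f w) (hg : IsLeadingWord g v)
    (h : LexLE (v * w) (w * v)) :
    superBracket k deg f g -
      superBracket k deg (single w (f.coeff w)) (single v (g.coeff v)) ∈
        supportedOn k {u | LenLexLT u (w * v)} := by
  have hlen : (v * w).length = (w * v).length := by
    rw [FreeMonoid.length_mul, FreeMonoid.length_mul, add_comm]
  have hle : ∀ u, LenLexLT u (v * w) → LenLexLT u (w * v) := by
    intro u hu
    rcases h with h | h
    · exact hu.trans (h.lenLexLT hlen)
    · rwa [← h]
  have e : superBracket k deg f g -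
      superBracket k deg (single w (f.coeff w)) (single v (g.coeff v)) =
      superBracket k deg (f - single w (f.coeff w)) g +
        superBracket k deg (single w (f.coeff w)) (g - single v (g.coeff v)) := by
    rw [map_sub, map_sub, LinearMap.sub_apply]
    abel
  rw [e]
  refine add_mem (superBracket_mem_supportedOn deg ?_ hf.sub_single_mem
      (Q := {u | u = v ∨ LenLexLT u v}) ?_)
    (superBracket_mem_supportedOn deg ?_ (single_mem_supportedOn (P := {w}) rfl _)
      hg.sub_single_mem)
  · rintro a ha b (rfl | hb)
    · exact ⟨ha.mul_right b, hle _ (ha.mul_left b)⟩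
    · exact ⟨(ha.mul_right b).trans (hb.mul_left w), hle _ ((hb.mul_right a).trans (ha.mul_left v))⟩
  · intro u hu
    by_cases h' : u = v
    exacts [Or.inl h', Or.inr (hg.2 u hu h')]
  · rintro a rfl b hb
    exact ⟨hb.mul_left a, hle _ (hb.mul_right a)⟩

/-- The leading word of a superbracket of two elements whose leading words do not commute. -/
theorem IsLeadingWord.bracket (deg : X → ZMod 2) {f g : MonoidAlgebra k (FreeMonoid X)}
    {w v : FreeMonoid X} (hf : IsLeadingWord f w) (hg : IsLeadingWord g v)
    (h : LexLT (v * w) (w * v)) :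
    IsLeadingWord (superBracket k deg f g) (w * v) ∧
      (superBracket k deg f g).coeff (w * v) = f.coeff w * g.coeff v := by
  have hlen : (v * w).length = (w * v).length := by
    rw [FreeMonoid.length_mul, FreeMonoid.length_mul, add_comm]
  refine isLeadingWord_of_sub_single_mem (mul_ne_zero hf.1 hg.1) ?_
  have h1 := superBracket_sub_single_mem deg hf hg h.le
  rw [superBracket_single] at h1
  have h2 := sub_mem h1 (single_mem_supportedOn (P := {u | LenLexLT u (w * v)}) (h.lenLexLT hlen)
    (f.coeff w * g.coeff v * (-1) ^ ((parity deg w).val * (parity deg v).val)))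
  rwa [sub_sub, sub_add_cancel] at h2

/-- The leading word of a superbracket of two elements with the same odd leading word. -/
theorem IsLeadingWord.bracket_self (deg : X → ZMod 2) (h2 : (2 : k) ≠ 0)
    {f g : MonoidAlgebra k (FreeMonoid X)} {w : FreeMonoid X} (hf : IsLeadingWord f w)
    (hg : IsLeadingWord g w) (hw : parity deg w = 1) :
    IsLeadingWord (superBracket k deg f g) (w * w) := by
  refine (isLeadingWord_of_sub_single_mem (c := 2 * (f.coeff w * g.coeff w))
    (mul_ne_zero h2 (mul_ne_zero hf.1 hg.1)) ?_).1
  have h1 := superBracket_sub_single_mem deg hf hg (LexLE.refl _)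
  rw [superBracket_single, hw, ← MonoidAlgebra.single_sub] at h1
  have e : (-1 : k) ^ ((1 : ZMod 2).val * (1 : ZMod 2).val) = -1 := by simp [ZMod.val_one]
  rw [e, mul_neg_one, sub_neg_eq_add, ← two_mul] at h1
  exact h1

theorem IsLSMonomial.isLeadingWord (deg : X → ZMod 2) {m : FreeMagma X} (hm : IsLSMonomial m) :
    IsLeadingWord (monomialEval k deg m) (rho m) ∧
      (monomialEval k deg m).coeff (rho m) = 1 := by
  induction hm with
  | of x =>
    refine isLeadingWord_of_sub_single_mem one_ne_zero ?_
    change single (FreeMonoid.of x) (1 : k) - single (FreeMonoid.of x) 1 ∈ _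
    rw [sub_self]
    exact zero_mem _
  | mul u w hu hw hlt hle ihu ihw =>
    have h := ihu.1.bracket deg ihw.1
      ((hu.isLSWord.mul hw.isLSWord hlt).rotate (rho_ne_one u) (rho_ne_one w))
    rw [ihu.2, ihw.2, mul_one] at h
    exact h

theorem IsSuperLSMonomial.isLeadingWord (h2 : (2 : k) ≠ 0) {deg : X → ZMod 2} {m : FreeMagma X}
    (hm : IsSuperLSMonomial deg m) : IsLeadingWord (monomialEval k deg m) (rho m) := by
  rcases hm with hm | ⟨m, hm, hodd, rfl⟩
  · exact (hm.isLeadingWord deg).1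
  · exact (hm.isLeadingWord deg).1.bracket_self deg h2 (hm.isLeadingWord deg).1 hodd

end Leading

/-! ### Existence of relative brackets -/

section RelativeBrackets

variable {X : Type*}

theorem occurrence_cases {u w a v b : FreeMonoid X} (h : u * w = a * v * b) :
    (∃ c, u = a * v * c ∧ b = c * w) ∨ (∃ c, a = u * c ∧ w = c * v * b) ∨
      ∃ p q, p ≠ 1 ∧ q ≠ 1 ∧ u = a * p ∧ v = p * q ∧ w = q * b := by
  rcases mul_eq_mul_cases h with ⟨q, hq, rfl⟩ | ⟨c, hc, hb⟩
  · rcases mul_eq_mul_cases hq.symm with ⟨d, rfl, rfl⟩ | ⟨p, rfl, rfl⟩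
    · exact Or.inr (Or.inl ⟨d, rfl, rfl⟩)
    by_cases hp : p = 1
    · subst hp
      exact Or.inr (Or.inl ⟨1, by simp, by simp⟩)
    by_cases hq : q = 1
    · subst hq
      exact Or.inl ⟨1, by simp, by simp⟩
    exact Or.inr (Or.inr ⟨p, q, hp, hq, rfl, rfl, rfl⟩)
  · exact Or.inl ⟨c, hc, hb⟩

theorem mul_self_eq_mul_cases {z p q : FreeMonoid X} (h : z * z = p * q) :
    (p = z ∧ q = z) ∨ (∃ c, c ≠ 1 ∧ p = z * c ∧ z = c * q) ∨
      ∃ c, c ≠ 1 ∧ z = p * c ∧ q = c * z := by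
  rcases mul_eq_mul_cases h with ⟨c, hp, hz⟩ | ⟨c, hz, hq⟩ <;> by_cases hc : c = 1
  · exact Or.inl ⟨by rw [hp, hc, mul_one], by rw [hz, hc, one_mul]⟩
  · exact Or.inr (Or.inl ⟨c, hc, hp, hz⟩)
  · exact Or.inl ⟨by rw [hz, hc, mul_one], by rw [hq, hc, one_mul]⟩
  · exact Or.inr (Or.inr ⟨c, hc, hz, hq⟩)

variable [LinearOrder X]

/-- Lyndon-Shirshov words and their squares. -/
def IsLSOrSquare (v : FreeMonoid X) : Prop := IsLSWord v ∨ ∃ z, IsLSWord z ∧ v = z * z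

theorem IsLSOrSquare.ne_one {v : FreeMonoid X} (h : IsLSOrSquare v) : v ≠ 1 := by
  rcases h with h | ⟨z, hz, rfl⟩
  exacts [h.1, freeMonoid_mul_ne_one_left hz.1]

/-- For v = zz, bracket the word as z(zc): c < zz < z makes zc Lyndon-Shirshov, and zc < z. -/
theorem IsLSOrSquare.mul {v c : FreeMonoid X} (h : IsLSOrSquare v) (hc : IsLSWord c)
    (hlt : LexLT c v) : IsLSWord (v * c) := by
  rcases h with h | ⟨z, hz, rfl⟩
  · exact h.mul hc hlt
  · rw [mul_assoc]
    exact hz.mul (hz.mul hc (hlt.trans_le (lexLE_mul_right z z))) (lexLT_mul_right hc.1)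

theorem IsSuperLSMonomial.isLSOrSquare {deg : X → ZMod 2} {m : FreeMagma X}
    (hm : IsSuperLSMonomial deg m) : IsLSOrSquare (rho m) := by
  rcases hm with hm | ⟨z, hz, -, rfl⟩
  exacts [Or.inl hm.isLSWord, Or.inr ⟨rho z, hz.isLSWord, rfl⟩]

variable {k : Type*} [Field k] (deg : X → ZMod 2)

/-- Bracketing from left to right with a nondecreasing sequence of Lyndon-Shirshov monomials. -/
theorem exists_context_append {s : MonoidAlgebra k (FreeMonoid X)} {L : List (FreeMagma X)}
    (hL : IsLSList L) {C : Context X} {w : FreeMonoid X} (hC : C.left = 1)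
    (hw : IsLSOrSquare w) (hs : IsLeadingWord (C.fill k deg s) w)
    (hwL : IsLSWord (w * (L.map rho).prod)) :
    ∃ D : Context X, D.left = 1 ∧ D.right = C.right * (L.map rho).prod ∧
      IsLeadingWord (D.fill k deg s) (w * (L.map rho).prod) := by
  induction L generalizing C w with
  | nil => exact ⟨C, hC, by simp, by simpa using hs⟩
  | cons c L ih =>
    have hc := (hL.1 c (by simp))
    -- The last factor d of the list is a proper suffix of the whole Lyndon-Shirshov word, so c ≤ d
    -- is smaller than that word, which is at most its prefix w.
    have hlt : LexLT (rho c) w := by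
      rcases List.eq_nil_or_concat L with rfl | ⟨L, d, rfl⟩
      · simp only [List.map_cons, List.map_nil, List.prod_cons, List.prod_nil, mul_one] at hwL
        exact (hwL.2 _ _ rfl hw.ne_one (rho_ne_one c)).trans_le (lexLE_mul_right _ _)
      · rw [List.concat_eq_append] at *
        simp only [List.map_cons, List.map_append, List.map_nil, List.prod_cons, List.prod_nil,
          List.prod_append, mul_one, ← mul_assoc] at hwL
        have h1 := hwL.2 _ _ rfl (freeMonoid_mul_ne_one_left
          (freeMonoid_mul_ne_one_left hw.ne_one)) (rho_ne_one d)
        have h2 : LexLE (rho c) (rho d) := (List.pairwise_cons.1 hL.2).1 d (by simp)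
        rw [mul_assoc, mul_assoc] at h1
        exact (h2.trans_lt h1).trans_le (lexLE_mul_right _ _)
    have hwc := hw.mul hc.isLSWord hlt
    rw [List.map_cons, List.prod_cons] at hwL ⊢
    rw [← mul_assoc] at hwL
    obtain ⟨D, h1, h2, h3⟩ := ih hL.of_cons (C := .mulRight C c) hC (Or.inl hwc)
      (hs.bracket deg (hc.isLeadingWord deg).1 (hwc.rotate hw.ne_one (rho_ne_one c))).1 hwL
    exact ⟨D, h1, h2.trans (mul_assoc _ _ _), by rwa [← mul_assoc]⟩

theorem exists_context_prefix {s : MonoidAlgebra k (FreeMonoid X)} {v b : FreeMonoid X}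
    (hs : IsLeadingWord s v) (hv : IsLSOrSquare v) (h : IsLSWord (v * b)) :
    ∃ C : Context X, C.left = 1 ∧ C.right = b ∧ IsLeadingWord (C.fill k deg s) (v * b) := by
  obtain ⟨L, hL, rfl⟩ := exists_isLSList b
  obtain ⟨D, h1, h2, h3⟩ := exists_context_append deg hL (C := .hole) (s := s) rfl hv hs h
  exact ⟨D, h1, by rw [h2]; exact one_mul _, h3⟩

/-- Otherwise pw would be a proper Lyndon-Shirshov suffix longer than w. -/
theorem IsLSMonomial.left_eq_one {u w : FreeMagma X} (h : IsLSMonomial (u * w))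
    {a p : FreeMonoid X} (hu : rho u = a * p) (hp : p ≠ 1) (hpw : IsLSWord (p * rho w)) :
    a = 1 := by
  by_contra ha
  obtain ⟨t, ht⟩ := h.exists_suffix (p := a) (r := p * rho w) (by rw [rho_mul, hu, mul_assoc])
    ha hpw
  have h1 := congrArg FreeMonoid.length ht
  have h2 := length_pos_of_ne_one hp
  simp only [FreeMonoid.length_mul] at h1
  omega

theorem IsLSMonomial.left_eq_one_of_overlap {u w : FreeMagma X} (h : IsLSMonomial (u * w))
    (hw : IsLSWord (rho w)) {a p q b : FreeMonoid X} (hua : rho u = a * p) (hwq : rho w = q * b)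
    (hp : p ≠ 1) (hq : q ≠ 1) (hpq : IsLSWord (p * q)) : a = 1 := by
  refine h.left_eq_one hua hp ?_
  rw [hwq] at hw ⊢
  rw [← mul_assoc]
  exact hpq.overlap hw hp hq

/-- Induction on the monomial uw. An occurrence of v inside one factor is handled by recursion. An
occurrence across the cut is normally forced to be a prefix, where left-to-right bracketing by the
factors of b applies; the exception is v = zz with the cut in its middle. -/
theorem IsLSMonomial.exists_context {m : FreeMagma X} (hm : IsLSMonomial m)
    {s : MonoidAlgebra k (FreeMonoid X)} {v : FreeMonoid X} (hs : IsLeadingWord s v)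
    (hv : IsLSOrSquare v) {a b : FreeMonoid X} (h : rho m = a * v * b) :
    ∃ C : Context X, C.left = a ∧ C.right = b ∧
      IsLeadingWord (C.fill k deg s) (a * v * b) := by
  induction hm generalizing a b with
  | of x =>
    have ha : a = 1 := by
      by_contra ha
      rw [mul_assoc] at h
      exact freeMonoid_mul_ne_one_left hv.ne_one (eq_one_of_of_eq_mul h ha)
    subst ha
    rw [one_mul] at h ⊢
    obtain rfl := eq_one_of_of_eq_mul h hv.ne_one
    exact ⟨.hole, rfl, rfl, by rwa [mul_one]⟩
  | mul u w hu hw hlt hle ihu ihw =>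
    have hm : IsLSMonomial (u * w) := .mul u w hu hw hlt hle
    have hrot := hm.isLSWord.rotate (rho_ne_one u) (rho_ne_one w)
    have hprefix : a = 1 → ∃ C : Context X, C.left = a ∧ C.right = b ∧
        IsLeadingWord (C.fill k deg s) (a * v * b) := by
      rintro rfl
      have := hm.isLSWord
      rw [rho_mul, ← rho_mul, show rho (u * w) = 1 * v * b from h, one_mul] at this
      rw [one_mul]
      exact exists_context_prefix deg hs hv this
    rcases occurrence_cases (show rho u * rho w = a * v * b from h) with
      ⟨c, hc, rfl⟩ | ⟨c, rfl, hc⟩ | ⟨p, q, hp, hq, hup, rfl, hwq⟩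
    · obtain ⟨C, rfl, rfl, h3⟩ := ihu hc
      refine ⟨.mulRight C w, rfl, rfl, ?_⟩
      rw [← h]
      rw [← hc] at h3
      exact (h3.bracket deg (hw.isLeadingWord deg).1 hrot).1
    · obtain ⟨C, rfl, rfl, h3⟩ := ihw hc
      refine ⟨.mulLeft u C, rfl, rfl, ?_⟩
      rw [← h]
      rw [← hc] at h3
      exact ((hu.isLeadingWord deg).1.bracket deg h3 hrot).1
    · rcases hv with hv | ⟨z, hz, hzz⟩
      · exact hprefix (hm.left_eq_one_of_overlap hw.isLSWord hup hwq hp hq hv)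
      -- The square zz is cut at its middle, in its second z, or in its first z. In the last two
      -- cases one copy of z itself straddles the cut, and the overlap argument applies to that
      -- copy.
      rcases mul_self_eq_mul_cases hzz.symm with ⟨rfl, rfl⟩ | ⟨c, hc, rfl, hzc⟩ | ⟨c, hc, hzc, rfl⟩
      · by_cases ha : a = 1
        · exact hprefix ha
        by_cases hb : b = 1
        · subst hb
          rw [mul_one] at hwq ⊢
          cases hu with
          | of x => exact (hp (eq_one_of_of_eq_mul hup ha)).elim
          | mul u₁ u₂ hu₁ hu₂ hlt' hle' =>
            obtain ⟨t, ht⟩ := (IsLSMonomial.mul u₁ u₂ hu₁ hu₂ hlt' hle').exists_suffix hup ha hz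
            have h1 : LexLE q (rho u₂) := by
              have := hu₂.isLSWord
              rw [ht] at this ⊢
              exact this.suffix_le hz.1
            have h2 : rho u₂ = q := by
              rcases hle u₁ u₂ rfl with h2 | h2
              · rw [hwq] at h2
                exact (h1.not_lt h2).elim
              · rw [h2, hwq]
            have h3 : rho u₁ = a := by
              change rho u₁ * rho u₂ = a * q at hup
              rw [h2] at hup
              exact mul_right_cancel hup
            -- The monomial is ((u₁ z) z), in which zz is not a bracketed subword; it is rebracketed
            -- as (u₁ (zz)).
            refine ⟨.mulLeft u₁ .hole, (mul_one _).trans h3, rfl, ?_⟩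
            have h4 : IsLSWord (a * (q * q)) := by
              have := hm.isLSWord
              rwa [rho_mul, hup, hwq, mul_assoc] at this
            rw [← h3] at h4 ⊢
            exact ((hu₁.isLeadingWord deg).1.bracket deg hs
              (h4.rotate (rho_ne_one _) (freeMonoid_mul_ne_one_left hp))).1
        · refine (ha (hm.left_eq_one hup hp (hz.mul hw.isLSWord ?_))).elim
          rw [hwq]
          exact lexLT_mul_right hb
      · have h1 : a * z = 1 := hm.left_eq_one_of_overlap hw.isLSWord (a := a * z)
          (by rw [hup, mul_assoc]) hwq hc hq (hzc ▸ hz)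
        have h2 := congrArg FreeMonoid.length h1
        have h3 := length_pos_of_ne_one hz.1
        rw [FreeMonoid.length_mul, FreeMonoid.length_one] at h2
        omega
      · exact hprefix (hm.left_eq_one_of_overlap hw.isLSWord (b := z * b) hup
          (by rw [hwq, mul_assoc]) hp hc (hzc ▸ hz))

/-- Existence of relative brackets. -/
theorem IsSuperLSMonomial.exists_context (h2 : (2 : k) ≠ 0) {m : FreeMagma X}
    (hm : IsSuperLSMonomial deg m) {s : MonoidAlgebra k (FreeMonoid X)} {v : FreeMonoid X}
    (hs : IsLeadingWord s v) (hv : IsLSOrSquare v) {a b : FreeMonoid X}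
    (h : rho m = a * v * b) :
    ∃ C : Context X, C.left = a ∧ C.right = b ∧
      IsLeadingWord (C.fill k deg s) (a * v * b) := by
  rcases hm with hm | ⟨y, hy, hodd, rfl⟩
  · exact hm.exists_context deg hs hv h
  have hyl := (hy.isLeadingWord (k := k) deg).1
  rcases occurrence_cases (show rho y * rho y = a * v * b from h) with
    ⟨c, hc, rfl⟩ | ⟨c, rfl, hc⟩ | ⟨p, q, hp, hq, hyp, rfl, hyq⟩
  · obtain ⟨C, rfl, rfl, h3⟩ := hy.exists_context deg hs hv hc
    refine ⟨.mulRight C y, rfl, rfl, ?_⟩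
    rw [← h]
    rw [← hc] at h3
    exact h3.bracket_self deg h2 hyl hodd
  · obtain ⟨C, rfl, rfl, h3⟩ := hy.exists_context deg hs hv hc
    refine ⟨.mulLeft y C, rfl, rfl, ?_⟩
    rw [← h]
    rw [← hc] at h3
    exact hyl.bracket_self deg h2 h3 hodd
  · rcases hv with hv | ⟨z, hz, hzz⟩
    · exact (hy.isLSWord.not_mul_of_suffix_prefix hyp hyq hp hq hv).elim
    rcases mul_self_eq_mul_cases hzz.symm with ⟨rfl, rfl⟩ | ⟨c, hc, rfl, hzc⟩ | ⟨c, hc, hzc, rfl⟩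
    -- Now y ends and begins with z, which forces y = z; the occurrence is the entire word, and the
    -- empty context suffices.
    · have ha : a = 1 := by
        by_contra ha
        have h1 := hy.isLSWord.2 a q hyp ha hq
        rw [hyq] at h1
        exact (lexLE_mul_right q b).not_lt h1
      subst ha
      have hb : b = 1 := by
        rw [hyq, one_mul] at hyp
        simpa using hyp
      subst hb
      exact ⟨.hole, rfl, rfl, by rwa [one_mul, mul_one]⟩
    · exact (hy.isLSWord.not_mul_of_suffix_prefix (a := a * z) (by rw [hyp, mul_assoc]) hyq hc hq
        (hzc ▸ hz)).elim
    · exact (hy.isLSWord.not_mul_of_suffix_prefix (b := z * b) hyp (by rw [hyq, mul_assoc]) hp hc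
        (hzc ▸ hz)).elim

end RelativeBrackets

/-! ### Super skew-symmetry and the super Jacobi identity -/

section Jacobi

variable {k : Type*} [Field k] {X : Type*} (deg : X → ZMod 2)

theorem superBracket_eval (m n : FreeMagma X) :
    superBracket k deg (monomialEval k deg m) (monomialEval k deg n) =
      monomialEval k deg m * monomialEval k deg n -
        (-1 : k) ^ ((parity deg (rho m)).val * (parity deg (rho n)).val) •
          (monomialEval k deg n * monomialEval k deg m) :=
  superBracket_eq deg (monomialEval_mem_parity deg m) (monomialEval_mem_parity deg n)

theorem superBracket_swap_mem {M : Submodule k (MonoidAlgebra k (FreeMonoid X))}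
    {m n : FreeMagma X} (h : monomialEval k deg (m * n) ∈ M) : monomialEval k deg (n * m) ∈ M := by
  rw [monomialEval_mul, superBracket_eval] at h ⊢
  rw [mul_comm (ZMod.val _)] at h
  rcases neg_one_pow_eq_or k ((parity deg (rho n)).val * (parity deg (rho m)).val) with e | e <;>
    rw [e] at h ⊢
  · rw [one_smul, ← neg_mem_iff, neg_sub] at h
    rwa [one_smul]
  · rw [neg_smul, one_smul, sub_neg_eq_add] at h ⊢
    rwa [add_comm]

theorem zmod_two_cases (i : ZMod 2) : i = 0 ∨ i = 1 := by
  revert i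
  decide

/-- The super Jacobi identity. -/
theorem superBracket_jacobi (m n p : FreeMagma X) :
    monomialEval k deg (m * n * p) = monomialEval k deg (m * (n * p)) -
      (-1 : k) ^ ((parity deg (rho m)).val * (parity deg (rho n)).val) •
        monomialEval k deg (n * (m * p)) := by
  rw [monomialEval_mul deg (m * n) p, monomialEval_mul deg m (n * p),
    monomialEval_mul deg n (m * p), superBracket_eval, superBracket_eval, superBracket_eval]
  simp only [rho_mul, parity_mul, monomialEval_mul, superBracket_eval]
  rcases zmod_two_cases (parity deg (rho m)) with hm | hm <;>
    rcases zmod_two_cases (parity deg (rho n)) with hn | hn <;>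
      rcases zmod_two_cases (parity deg (rho p)) with hp | hp <;>
        simp [hm, hn, hp, ZMod.val_one, CharTwo.add_self_eq_zero] <;> noncomm_ring

theorem superBracket_jacobi_mem {M : Submodule k (MonoidAlgebra k (FreeMonoid X))}
    {m n p : FreeMagma X} (h₁ : monomialEval k deg (m * (n * p)) ∈ M)
    (h₂ : monomialEval k deg (n * (m * p)) ∈ M) : monomialEval k deg (m * n * p) ∈ M := by
  rw [superBracket_jacobi]
  exact sub_mem h₁ (M.smul_mem _ h₂)

theorem monomialEval_mul_self_of_even {m : FreeMagma X} (hm : parity deg (rho m) = 0) :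
    monomialEval k deg (m * m) = 0 := by
  rw [monomialEval_mul, superBracket_eval, hm]
  simp

/-- For odd m the bracket [m, m] is 2m² in the associative algebra and commutes with m, so no
division by 3 is involved. -/
theorem monomialEval_mul_self_mul {m : FreeMagma X} : monomialEval k deg (m * m * m) = 0 := by
  rcases zmod_two_cases (parity deg (rho m)) with hm | hm
  · rw [monomialEval_mul, monomialEval_mul_self_of_even deg hm]
    simp
  · rw [monomialEval_mul, superBracket_eval, rho_mul, parity_mul, monomialEval_mul,
      superBracket_eval, hm]
    simp [ZMod.val_one, CharTwo.add_self_eq_zero]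
    noncomm_ring

theorem content_card_pos (m : FreeMagma X) : 0 < (content (rho m)).card :=
  length_pos_of_ne_one (rho_ne_one m)

end Jacobi

/-! ### Super-Lyndon-Shirshov monomials span the free Lie superalgebra -/

section Spanning

variable (k : Type*) [Field k] {X : Type*} [LinearOrder X] (deg : X → ZMod 2)

/-- `m` is a super-Lyndon-Shirshov monomial, equal to the Lyndon-Shirshov monomial `c` or to
its square. -/
def IsRoot (c m : FreeMagma X) : Prop :=
  IsLSMonomial c ∧ (m = c ∨ (m = c * c ∧ parity deg (rho c) = 1))

/-- The span of the super-Lyndon-Shirshov monomials of content `κ` whose root is greater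
than `b`. -/
noncomputable def rootSpan (κ : Multiset X) (b : FreeMonoid X) :
    Submodule k (MonoidAlgebra k (FreeMonoid X)) :=
  Submodule.span k {f | ∃ c m, IsRoot deg c m ∧ content (rho m) = κ ∧ LexLT b (rho c) ∧
    f = monomialEval k deg m}

/-- The superbrackets of content `κ` of monomials with root `b` and monomials with a greater root
are combinations of monomials with a root greater than `b`. -/
def BracketRaises (κ : Multiset X) (b : FreeMagma X) : Prop :=
  ∀ c m n, IsRoot deg c m → IsRoot deg b n → LexLT (rho b) (rho c) →
    content (rho m) + content (rho n) = κ →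
      monomialEval k deg (m * n) ∈ rootSpan k deg κ (rho b)

variable {k deg}

theorem IsRoot.self {c : FreeMagma X} (hc : IsLSMonomial c) : IsRoot deg c c :=
  ⟨hc, Or.inl rfl⟩

theorem isSuperLSMonomial_iff {m : FreeMagma X} :
    IsSuperLSMonomial deg m ↔ ∃ c, IsRoot deg c m := by
  constructor
  · rintro (h | ⟨v, hv, hodd, rfl⟩)
    exacts [⟨m, .self h⟩, ⟨v, hv, Or.inr ⟨rfl, hodd⟩⟩]
  · rintro ⟨c, hc, rfl | ⟨rfl, hodd⟩⟩
    exacts [Or.inl hc, Or.inr ⟨c, hc, hodd, rfl⟩]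

theorem IsRoot.content_le {c m : FreeMagma X} (h : IsRoot deg c m) :
    content (rho c) ≤ content (rho m) := by
  rcases h.2 with rfl | ⟨rfl, -⟩
  · exact le_rfl
  · rw [rho_mul, content_mul]
    exact Multiset.le_add_left _ _

theorem IsRoot.mem_rootSpan {c m : FreeMagma X} (h : IsRoot deg c m) {κ : Multiset X}
    (hκ : content (rho m) = κ) {b : FreeMonoid X} (hb : LexLT b (rho c)) :
    monomialEval k deg m ∈ rootSpan k deg κ b :=
  Submodule.subset_span ⟨c, m, h, hκ, hb, rfl⟩

theorem rootSpan_anti {κ : Multiset X} {b b' : FreeMonoid X} (h : LexLT b b') :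
    rootSpan k deg κ b' ≤ rootSpan k deg κ b := by
  refine Submodule.span_mono ?_
  rintro f ⟨c, m, h₁, h₂, h₃, rfl⟩
  exact ⟨c, m, h₁, h₂, h.trans h₃, rfl⟩

/-- Apply `H` at the smaller of the two roots, which still exceeds b. Equal roots give zero or the
square of an odd monomial. -/
theorem monomialEval_mul_mem_rootSpan {κ : Multiset X} {b : FreeMonoid X}
    (H : ∀ d, IsLSMonomial d → LexLT b (rho d) → content (rho d) ≤ κ → BracketRaises k deg κ d)
    {c d m n : FreeMagma X} (hm : IsRoot deg c m) (hn : IsRoot deg d n) (hc : LexLT b (rho c))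
    (hd : LexLT b (rho d)) (hκ : content (rho m) + content (rho n) = κ) :
    monomialEval k deg (m * n) ∈ rootSpan k deg κ b := by
  have hcκ : content (rho c) ≤ κ := hκ ▸ hm.content_le.trans (Multiset.le_add_right _ _)
  have hdκ : content (rho d) ≤ κ := hκ ▸ hn.content_le.trans (Multiset.le_add_left _ _)
  rcases lexLT_trichotomy (rho c) (rho d) with h | h | h
  · exact superBracket_swap_mem deg (rootSpan_anti hc
      (H c hm.1 hc hcκ d n m hn hm h (by rw [add_comm, hκ])))
  · obtain rfl := hm.1.ext hn.1 h
    rcases hm.2 with rfl | ⟨rfl, hodd⟩ <;> rcases hn.2 with rfl | ⟨rfl, hodd'⟩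
    · rcases zmod_two_cases (parity deg (rho n)) with h0 | h1
      · rw [monomialEval_mul_self_of_even deg h0]
        exact zero_mem _
      · exact IsRoot.mem_rootSpan (c := n) ⟨hn.1, Or.inr ⟨rfl, h1⟩⟩
          (by rw [rho_mul, content_mul, hκ]) hc
    · refine superBracket_swap_mem deg ?_
      rw [monomialEval_mul_self_mul]
      exact zero_mem _
    · rw [monomialEval_mul_self_mul]
      exact zero_mem _
    · rw [monomialEval_mul_self_of_even deg (by
        rw [rho_mul, parity_mul, CharTwo.add_self_eq_zero])]
      exact zero_mem _
  · exact rootSpan_anti hd (H d hn.1 hd hdκ c m n hm hn h hκ)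

theorem superBracket_mem_rootSpan {κ κ₁ κ₂ : Multiset X} {b : FreeMonoid X} (hκ : κ₁ + κ₂ = κ)
    (H : ∀ d, IsLSMonomial d → LexLT b (rho d) → content (rho d) ≤ κ → BracketRaises k deg κ d)
    {f g : MonoidAlgebra k (FreeMonoid X)} (hf : f ∈ rootSpan k deg κ₁ b)
    (hg : g ∈ rootSpan k deg κ₂ b) : superBracket k deg f g ∈ rootSpan k deg κ b := by
  induction hf using Submodule.span_induction with
  | zero => simp
  | add x y _ _ hx hy =>
    rw [map_add, LinearMap.add_apply]
    exact add_mem hx hy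
  | smul a x _ hx =>
    rw [map_smul, LinearMap.smul_apply]
    exact Submodule.smul_mem _ _ hx
  | mem x hx =>
    obtain ⟨c, m, hm, rfl, hc, rfl⟩ := hx
    induction hg using Submodule.span_induction with
    | zero => simp
    | add x y _ _ hx hy =>
      rw [map_add]
      exact add_mem hx hy
    | smul a x _ hx =>
      rw [map_smul]
      exact Submodule.smul_mem _ _ hx
    | mem y hy =>
      obtain ⟨d, n, hn, rfl, hd, rfl⟩ := hy
      exact monomialEval_mul_mem_rootSpan H hm hn hc hd hκ

/-- The form of the terms produced by Jacobi: the inner bracket has smaller degree, so `H₁` raises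
its roots above b; then both arguments of the outer bracket have roots above b and `H₂` applies. -/
theorem bracket_mem_rootSpan_of_factor {κ : Multiset X} {b : FreeMagma X}
    (H₁ : ∀ κ' : Multiset X, κ'.card < κ.card → ∀ d, BracketRaises k deg κ' d)
    (H₂ : ∀ d, IsLSMonomial d → LexLT (rho b) (rho d) → content (rho d) ≤ κ →
      BracketRaises k deg κ d)
    {c a n x : FreeMagma X} (hx : IsRoot deg c x) (hc : LexLT (rho b) (rho c))
    (ha : IsLSMonomial a) (hab : LexLT (rho b) (rho a)) (hn : IsRoot deg b n)
    (hκ : content (rho x) + (content (rho a) + content (rho n)) = κ) :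
    monomialEval k deg (x * (a * n)) ∈ rootSpan k deg κ (rho b) := by
  refine superBracket_mem_rootSpan hκ H₂ (hx.mem_rootSpan rfl hc)
    (H₁ _ ?_ b a a n (.self ha) hn hab rfl)
  have := content_card_pos x
  rw [← hκ, Multiset.card_add (content (rho x))]
  simp only [Multiset.card_add] at *
  omega

/-- Either ab is already a Lyndon-Shirshov monomial, greater than its suffix b, or a = a₁a₂ with a₂
> b. Then Jacobi moves b inside, and both a₁ and a₂ exceed b. -/
theorem bracketRaises_LS {κ : Multiset X} {b : FreeMagma X}
    (hb : IsLSMonomial b)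
    (H₁ : ∀ κ' : Multiset X, κ'.card < κ.card → ∀ d, BracketRaises k deg κ' d)
    (H₂ : ∀ d, IsLSMonomial d → LexLT (rho b) (rho d) → content (rho d) ≤ κ →
      BracketRaises k deg κ d)
    {a : FreeMagma X} (ha : IsLSMonomial a) (hab : LexLT (rho b) (rho a))
    (hκ : content (rho a) + content (rho b) = κ) :
    monomialEval k deg (a * b) ∈ rootSpan k deg κ (rho b) := by
  have key : IsLSMonomial (a * b) → monomialEval k deg (a * b) ∈ rootSpan k deg κ (rho b) :=
    fun h => (IsRoot.self h).mem_rootSpan (by rw [rho_mul, content_mul, hκ])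
      (h.isLSWord.2 _ _ rfl (rho_ne_one a) (rho_ne_one b))
  have ha' := ha
  cases ha with
  | of x => exact key (.mul _ _ ha' hb hab fun v₁ v₂ h => by simp at h)
  | mul a₁ a₂ h₁ h₂ hlt hle =>
    rcases lexLT_or_le (rho b) (rho a₂) with h | h
    · change content (rho a₁ * rho a₂) + _ = κ at hκ
      rw [content_mul] at hκ
      refine superBracket_jacobi_mem deg
        (bracket_mem_rootSpan_of_factor H₁ H₂ (.self h₁) (h.trans hlt) h₂ h (.self hb) ?_)
        (bracket_mem_rootSpan_of_factor H₁ H₂ (.self h₂) h h₁ (h.trans hlt) (.self hb) ?_)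
      · rw [← hκ, add_assoc]
      · rw [← hκ, add_left_comm, add_assoc]
    · refine key (.mul _ _ ha' hb hab fun v₁ v₂ h' => ?_)
      obtain ⟨-, rfl⟩ := freeMagma_mul_inj (show a₁ * a₂ = v₁ * v₂ from h')
      exact h

theorem bracketRaises_sq {κ : Multiset X} {b : FreeMagma X}
    (H₁ : ∀ κ' : Multiset X, κ'.card < κ.card → ∀ d, BracketRaises k deg κ' d)
    (H₂ : ∀ d, IsLSMonomial d → LexLT (rho b) (rho d) → content (rho d) ≤ κ →
      BracketRaises k deg κ d)
    {a n : FreeMagma X} (ha : IsLSMonomial a)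
    (hab : LexLT (rho b) (rho a)) (hn : IsRoot deg b n)
    (hκ : content (rho (a * a)) + content (rho n) = κ) :
    monomialEval k deg (a * a * n) ∈ rootSpan k deg κ (rho b) := by
  rw [rho_mul, content_mul, add_assoc] at hκ
  have := bracket_mem_rootSpan_of_factor H₁ H₂ (.self ha) hab ha hab hn hκ
  exact superBracket_jacobi_mem deg this this

theorem bracketRaises_step {κ : Multiset X} {b : FreeMagma X}
    (hb : IsLSMonomial b)
    (H₁ : ∀ κ' : Multiset X, κ'.card < κ.card → ∀ d, BracketRaises k deg κ' d)
    (H₂ : ∀ d, IsLSMonomial d → LexLT (rho b) (rho d) → content (rho d) ≤ κ →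
      BracketRaises k deg κ d) :
    BracketRaises k deg κ b := by
  intro a m n hm hn hab hκ
  rcases hm.2 with rfl | ⟨rfl, hodd⟩
  · rcases hn.2 with rfl | ⟨rfl, hodd'⟩
    · exact bracketRaises_LS hb H₁ H₂ hm.1 hab hκ
    · refine superBracket_swap_mem deg ?_
      -- Jacobi turns [[b, b], m] into two terms [b, [b, m]]. The outer b is not above b, so `H₂`
      -- does not apply directly: the inner bracket is first expanded into monomials with root above
      -- b, and each is bracketed with the single b.
      suffices h : monomialEval k deg (b * (b * m)) ∈ rootSpan k deg κ (rho b) from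
        superBracket_jacobi_mem deg h h
      rw [rho_mul, content_mul] at hκ
      have h1 : monomialEval k deg (b * m) ∈
          rootSpan k deg (content (rho m) + content (rho b)) (rho b) := by
        refine superBracket_swap_mem deg (H₁ _ ?_ b m m b hm (.self hb) hab rfl)
        have := content_card_pos b
        simp only [← hκ, Multiset.card_add]
        omega
      rw [monomialEval_mul]
      generalize monomialEval k deg (b * m) = f at h1
      induction h1 using Submodule.span_induction with
      | zero => simp
      | add x y _ _ hx hy =>
        rw [map_add]
        exact add_mem hx hy
      | smul a x _ hx =>
        rw [map_smul]
        exact Submodule.smul_mem _ _ hx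
      | mem y hy =>
        obtain ⟨d, p, hp, hpκ, hd, rfl⟩ := hy
        have hκ' : content (rho p) + content (rho b) = κ := by rw [hpκ, ← hκ, add_assoc]
        rw [← monomialEval_mul]
        refine superBracket_swap_mem deg ?_
        rcases hp.2 with rfl | ⟨rfl, hodd⟩
        · exact bracketRaises_LS hb H₁ H₂ hp.1 hd hκ'
        · exact bracketRaises_sq H₁ H₂ hp.1 hd (.self hb) hκ'
  · exact bracketRaises_sq H₁ H₂ hm.1 hab hn hκ

theorem finite_content_le (κ : Multiset X) : {u : FreeMonoid X | content u ≤ κ}.Finite := by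
  classical
  refine Set.Finite.preimage' (f := content) (Set.finite_Iic κ) fun s _ => ?_
  induction s using Quotient.inductionOn with
  | _ l =>
  refine (l.permutations.toFinset.finite_toSet).subset fun u hu => ?_
  simpa using Multiset.coe_eq_coe.1 (show ((u : List X) : Multiset X) = l from hu)

/-- Induction on degree and, within a fixed content κ, downward on the root. Increasing
lexicographical chains terminate because only finitely many words have content at most κ. -/
theorem bracketRaises (κ : Multiset X) (b : FreeMagma X) : BracketRaises k deg κ b := by
  induction h : κ.card using Nat.strong_induction_on generalizing κ b with
  | _ N ih =>
  subst h
  let r : FreeMonoid X → FreeMonoid X → Prop := fun u v => LexLT v u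
  have : IsStrictOrder (FreeMonoid X) r :=
    { irrefl := fun u => LexLT.irrefl u
      trans := fun _ _ _ h₁ h₂ => LexLT.trans h₂ h₁ }
  have hwf := (finite_content_le κ).wellFoundedOn (r := r)
  intro c m n hm hn hbc hκ
  have hbκ : content (rho b) ≤ κ := hκ ▸ hn.content_le.trans (Multiset.le_add_left _ _)
  refine hwf.induction (P := fun w => ∀ b, IsLSMonomial b → rho b = w → BracketRaises k deg κ b)
    hbκ ?_ b hn.1 rfl c m n hm hn hbc hκ
  rintro w hw IH b hb rfl
  exact bracketRaises_step hb (fun κ' hκ' d => ih _ hκ' κ' d rfl)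
    fun d hd hbd hdκ => IH (rho d) hdκ hbd d hd rfl

variable (k deg)

/-- The free Lie superalgebra is spanned by the super-Lyndon-Shirshov monomials. -/
theorem freeLie_le_span : freeLie k deg ≤
    Submodule.span k (monomialEval k deg '' {m | IsSuperLSMonomial deg m}) := by
  refine sInf_le ⟨fun x => Submodule.subset_span ⟨.of x, Or.inl (.of x), rfl⟩, ?_⟩
  have hle : ∀ κ b, rootSpan k deg κ b ≤
      Submodule.span k (monomialEval k deg '' {m | IsSuperLSMonomial deg m}) := by
    intro κ b
    refine Submodule.span_mono ?_
    rintro f ⟨c, m, hm, -, -, rfl⟩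
    exact ⟨m, isSuperLSMonomial_iff.2 ⟨c, hm⟩, rfl⟩
  intro f hf g hg
  induction hf using Submodule.span_induction with
  | zero => simp
  | add x y _ _ hx hy =>
    rw [map_add, LinearMap.add_apply]
    exact add_mem hx hy
  | smul a x _ hx =>
    rw [map_smul, LinearMap.smul_apply]
    exact Submodule.smul_mem _ _ hx
  | mem x hx =>
    obtain ⟨m, hm, rfl⟩ := hx
    induction hg using Submodule.span_induction with
    | zero => simp
    | add x y _ _ hx hy =>
      rw [map_add]
      exact add_mem hx hy
    | smul a x _ hx =>
      rw [map_smul]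
      exact Submodule.smul_mem _ _ hx
    | mem y hy =>
      obtain ⟨n, hn, rfl⟩ := hy
      obtain ⟨c, hc⟩ := isSuperLSMonomial_iff.1 hm
      obtain ⟨d, hd⟩ := isSuperLSMonomial_iff.1 hn
      -- Any strict lower bound of both roots will do. A word is greater than its square, so the
      -- square of the smaller root serves.
      obtain ⟨b, hbc, hbd⟩ : ∃ b, LexLT b (rho c) ∧ LexLT b (rho d) := by
        have hsq : ∀ c : FreeMagma X, LexLT (rho c * rho c) (rho c) :=
          fun c => lexLT_mul_right (rho_ne_one c)
        rcases lexLT_or_le (rho c) (rho d) with h | h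
        · exact ⟨_, hsq c, (hsq c).trans h⟩
        · exact ⟨_, (hsq d).trans_le h, hsq d⟩
      exact hle _ b (monomialEval_mul_mem_rootSpan
        (fun d _ _ _ => bracketRaises _ d) hc hd hbc hbd rfl)

end Spanning

/-! ### Leading words in the free Lie superalgebra and descent along ≪ -/

section Reduction

variable {k : Type*} [Field k] {X : Type*} [LinearOrder X]

/-- The leading word of a nonzero element of the free Lie superalgebra is a
super-Lyndon-Shirshov word. -/
theorem exists_isSuperLSMonomial_of_isLeadingWord (h2 : (2 : k) ≠ 0) {deg : X → ZMod 2}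
    {f : MonoidAlgebra k (FreeMonoid X)} (hf : f ∈ freeLie k deg) {w : FreeMonoid X}
    (hw : IsLeadingWord f w) : ∃ m, IsSuperLSMonomial deg m ∧ rho m = w := by
  classical
  obtain ⟨l, hl, rfl⟩ := (Finsupp.mem_span_image_iff_linearCombination k).1
    (freeLie_le_span k deg hf)
  have hcoeff : ∀ u, (Finsupp.linearCombination k (monomialEval k deg) l).coeff u =
      ∑ m ∈ l.support, l m * (monomialEval k deg m).coeff u := by
    intro u
    rw [Finsupp.linearCombination_apply, Finsupp.sum, MonoidAlgebra.coeff_sum,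
      Finsupp.finsetSum_apply]
    simp
  have hS : ∀ m ∈ l.support, IsSuperLSMonomial deg m := fun m hm => hl hm
  have hle : ∀ m ∈ l.support, ∀ u, (monomialEval k deg m).coeff u ≠ 0 →
      u = rho m ∨ LenLexLT u (rho m) := fun m hm u hu =>
    or_iff_not_imp_left.2 (((hS m hm).isLeadingWord h2).2 u hu)
  obtain ⟨m, hm, hmw⟩ : ∃ m ∈ l.support, (monomialEval k deg m).coeff w ≠ 0 := by
    have h := hw.1
    rw [hcoeff] at h
    obtain ⟨m, hm, h⟩ := Finset.exists_ne_zero_of_sum_ne_zero h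
    exact ⟨m, hm, right_ne_zero_of_mul h⟩
  -- Distinct monomials of the combination have distinct leading words, so the term at the largest
  -- of them cannot cancel; that word must be w.
  obtain ⟨v, hv, hmax⟩ := exists_lenLexLT_max (s := l.support.image rho)
    ⟨_, Finset.mem_image_of_mem rho hm⟩
  obtain ⟨n, hn, rfl⟩ := Finset.mem_image.1 hv
  refine ⟨n, hS n hn, ?_⟩
  by_contra hne
  have hnw : LenLexLT (rho n) w := by
    refine hw.2 _ ?_ hne
    rw [hcoeff, Finset.sum_eq_single_of_mem n hn]
    · exact mul_ne_zero (Finsupp.mem_support_iff.1 hn) ((hS n hn).isLeadingWord h2).1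
    · intro m' hm' hmn
      have hρ : rho m' ≠ rho n := fun h => hmn ((hS m' hm').ext (hS n hn) h)
      rw [mul_eq_zero]
      right
      by_contra h0
      have h1 := hmax _ (Finset.mem_image_of_mem rho hm') hρ
      rcases hle m' hm' _ h0 with h | h
      · exact hρ h.symm
      · exact LenLexLT.irrefl _ (h.trans h1)
  have hwm : LenLexLT (rho n) (rho m) := by
    rcases hle m hm w hmw with h | h
    exacts [h ▸ hnw, hnw.trans h]
  exact LenLexLT.irrefl _ (hwm.trans (hmax _ (Finset.mem_image_of_mem rho hm)
    fun h => LenLexLT.irrefl _ (h ▸ hwm)))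

/-- If every leading word below `w` of an element of `M` is the leading word of an element of
`M ⊓ N`, then the elements of `M` all of whose words lie below `w` belong to `N`. -/
theorem mem_of_forall_isLeadingWord [WellFoundedLT X]
    {M N : Submodule k (MonoidAlgebra k (FreeMonoid X))} {w : FreeMonoid X}
    (h : ∀ f ∈ M, ∀ u, IsLeadingWord f u → LenLexLT u w →
      ∃ g ∈ M, g ∈ N ∧ IsLeadingWord g u) {f : MonoidAlgebra k (FreeMonoid X)} (hf : f ∈ M)
    (hfw : f ∈ supportedOn k {u | LenLexLT u w}) : f ∈ N := by
  have key : ∀ u, LenLexLT u w → ∀ f ∈ M, IsLeadingWord f u → f ∈ N := by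
    intro u
    induction u using (wellFounded_lenLexLT (X := X)).induction with
    | _ u ih =>
    intro huw f hf hfu
    obtain ⟨g, hgM, hgN, hgu⟩ := h f hf u hfu huw
    have hc : f.coeff u * (g.coeff u)⁻¹ ≠ 0 := mul_ne_zero hfu.1 (inv_ne_zero hgu.1)
    set c := f.coeff u * (g.coeff u)⁻¹ with hcdef
    have hsub := hfu.sub_mem_supportedOn (hgu.smul hc) (by
      rw [MonoidAlgebra.coeff_smul_apply, smul_eq_mul, hcdef, inv_mul_cancel_right₀ hgu.1])
    rw [← sub_add_cancel f (c • g)]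
    refine add_mem ?_ (N.smul_mem c hgN)
    by_cases h0 : f - c • g = 0
    · rw [h0]
      exact zero_mem _
    obtain ⟨v, hv⟩ := exists_isLeadingWord h0
    have hvu : LenLexLT v u := hsub v hv.1
    exact ih v hvu (hvu.trans huw) _ (sub_mem hf (M.smul_mem c hgM)) hv
  by_cases h0 : f = 0
  · rw [h0]
    exact zero_mem _
  obtain ⟨v, hv⟩ := exists_isLeadingWord h0
  exact key v (hfw v hv.1) f hf hv

/-- If the part of an element of `I` complementary to `V ≤ I` is spanned by a family which is
linearly independent modulo `I`, then the element lies in `V`. -/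
theorem mem_of_mem_sup_span {M M' ι : Type*} [AddCommGroup M] [Module k M] [AddCommGroup M']
    [Module k M'] (π : M →ₗ[k] M') {v : ι → M} (hv : LinearIndependent k (π ∘ v))
    {V : Submodule k M} (hV : V ≤ LinearMap.ker π) {f : M}
    (hf : f ∈ V ⊔ Submodule.span k (Set.range v)) (hf' : f ∈ LinearMap.ker π) : f ∈ V := by
  obtain ⟨x, hx, r, hr, rfl⟩ := Submodule.mem_sup.1 hf
  have hr' : r ∈ LinearMap.ker π := by
    have := sub_mem hf' (hV hx)
    rwa [add_sub_cancel_left] at this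
  have := (Submodule.disjoint_def.1 (Submodule.range_ker_disjoint hv)) r hr hr'
  rwa [this, add_zero]

end Reduction

/-! ### The associative case -/

section Associative

variable {k : Type*} [Field k] {X : Type*}

/-- The quotient map onto `k⟨X⟩ / J`. -/
noncomputable def envelopingMk (S : Set (MonoidAlgebra k (FreeMonoid X))) :
    MonoidAlgebra k (FreeMonoid X) →ₗ[k] EnvelopingQuotient k S where
  toFun f := f
  map_add' _ _ := rfl
  map_smul' _ _ := rfl

theorem mem_ker_envelopingMk {S : Set (MonoidAlgebra k (FreeMonoid X))}
    {f : MonoidAlgebra k (FreeMonoid X)} :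
    f ∈ LinearMap.ker (envelopingMk S) ↔ f ∈ TwoSidedIdeal.span S := by
  rw [LinearMap.mem_ker, TwoSidedIdeal.mem_iff]
  exact RingCon.eq _

variable [LinearOrder X]

theorem IsLeadingWord.single_mul_mul {f : MonoidAlgebra k (FreeMonoid X)} {w : FreeMonoid X}
    (h : IsLeadingWord f w) (a b : FreeMonoid X) :
    IsLeadingWord (single a 1 * f * single b 1) (a * w * b) ∧
      (single a 1 * f * single b 1).coeff (a * w * b) = f.coeff w := by
  refine isLeadingWord_of_sub_single_mem h.1 ?_
  have e : single a 1 * f * single b 1 - single (a * w * b) (f.coeff w) =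
      single a 1 * (f - single w (f.coeff w)) * single b 1 := by
    rw [mul_sub, sub_mul, MonoidAlgebra.single_mul_single, MonoidAlgebra.single_mul_single,
      one_mul, mul_one]
  rw [e]
  refine supportedOn_induction h.sub_single_mem (p := fun f => single a 1 * f * single b 1 ∈
    supportedOn k {u | LenLexLT u (a * w * b)}) ?_ (fun f g hf hg => ?_) fun u hu c => ?_
  · simp
  · rw [mul_add, add_mul]
    exact add_mem hf hg
  · rw [MonoidAlgebra.single_mul_single, MonoidAlgebra.single_mul_single]
    exact single_mem_supportedOn ((hu.mul_left a).mul_right b) _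

variable {S : Set (MonoidAlgebra k (FreeMonoid X))}

/-- Descent writes f as an admissible combination of elements asb plus a combination of reduced
words; the latter lies in the ideal and vanishes by independence. -/
theorem congrAssoc_zero_of_mem [WellFoundedLT X]
    (hS : LinearIndependent k (fun u : {u : FreeMonoid X // IsReduced S u} =>
      envelopingMk S (single (u : FreeMonoid X) (1 : k))))
    {w : FreeMonoid X} {f : MonoidAlgebra k (FreeMonoid X)} (hf : f ∈ TwoSidedIdeal.span S)
    (hfw : f ∈ supportedOn k {u | LenLexLT u w}) : CongrAssoc S w f 0 := by
  rw [CongrAssoc, sub_zero]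
  refine mem_of_mem_sup_span (envelopingMk S) hS ?_ ?_ (mem_ker_envelopingMk.2 hf)
  · rw [Submodule.span_le]
    rintro h ⟨s, hs, v, a, b, -, -, rfl⟩
    refine mem_ker_envelopingMk.2 ?_
    exact TwoSidedIdeal.mul_mem_right _ _ _
      (TwoSidedIdeal.mul_mem_left _ _ _ (TwoSidedIdeal.subset_span hs))
  · refine mem_of_forall_isLeadingWord (M := ⊤) (fun f _ u _ huw => ?_) Submodule.mem_top hfw
    by_cases hu : IsReduced S u
    · refine ⟨single u 1, Submodule.mem_top,
        Submodule.mem_sup_right (Submodule.subset_span ⟨⟨u, hu⟩, rfl⟩), ?_⟩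
      refine (isLeadingWord_of_sub_single_mem one_ne_zero ?_).1
      rw [sub_self]
      exact zero_mem _
    · simp only [IsReduced, not_forall, not_not] at hu
      obtain ⟨s, hs, v, hv, a, b, rfl⟩ := hu
      exact ⟨_, Submodule.mem_top, Submodule.mem_sup_left
        (Submodule.subset_span ⟨s, hs, v, a, b, hv, huw, rfl⟩), (hv.single_mul_mul a b).1⟩

theorem closedAssoc_of_linearIndependent [WellFoundedLT X] (hmonic : ∀ s ∈ S, IsMonic s)
    (hS : LinearIndependent k (fun u : {u : FreeMonoid X // IsReduced S u} =>
      envelopingMk S (single (u : FreeMonoid X) (1 : k)))) : ClosedAssoc S := by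
  intro p hp q hq u v hu hv
  have hpJ : p ∈ TwoSidedIdeal.span S := TwoSidedIdeal.subset_span hp
  have hqJ : q ∈ TwoSidedIdeal.span S := TwoSidedIdeal.subset_span hq
  have hp1 := (hmonic p hp).coeff_eq_one hu
  have hq1 := (hmonic q hq).coeff_eq_one hv
  refine ⟨fun a b hab _ => congrAssoc_zero_of_mem hS ?_ ?_,
    fun a b hab => congrAssoc_zero_of_mem hS ?_ ?_⟩
  · exact sub_mem (TwoSidedIdeal.mul_mem_right _ _ _ hpJ) (TwoSidedIdeal.mul_mem_left _ _ _ hqJ)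
  · have h1 := hu.single_mul_mul 1 a
    have h2 := hv.single_mul_mul b 1
    rw [← MonoidAlgebra.one_def, one_mul, one_mul] at h1
    rw [← MonoidAlgebra.one_def, mul_one, mul_one, ← hab] at h2
    exact h1.1.sub_mem_supportedOn h2.1 (by rw [h1.2, h2.2, hp1, hq1])
  · exact sub_mem hpJ (TwoSidedIdeal.mul_mem_right _ _ _ (TwoSidedIdeal.mul_mem_left _ _ _ hqJ))
  · have h2 := hv.single_mul_mul a b
    rw [← hab] at h2
    exact hu.sub_mem_supportedOn h2.1 (by rw [h2.2, hp1, hq1])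

end Associative

/-! ### The Lie case -/

section Lie

variable {k : Type*} [Field k] {X : Type*} {deg : X → ZMod 2}
  {S : Set (MonoidAlgebra k (FreeMonoid X))}

theorem superBracket_mem_freeLie {f g : MonoidAlgebra k (FreeMonoid X)}
    (hf : f ∈ freeLie k deg) (hg : g ∈ freeLie k deg) :
    superBracket k deg f g ∈ freeLie k deg :=
  Submodule.mem_sInf.2 fun M hM =>
    hM.2 f (Submodule.mem_sInf.1 hf M hM) g (Submodule.mem_sInf.1 hg M hM)

theorem subset_lieIdeal : S ⊆ lieIdeal k deg S :=
  fun _ hs => Submodule.mem_sInf.2 fun _ hM => hM.1 hs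

theorem superBracket_mem_lieIdeal {f g : MonoidAlgebra k (FreeMonoid X)}
    (hf : f ∈ lieIdeal k deg S) (hg : g ∈ freeLie k deg) :
    superBracket k deg f g ∈ lieIdeal k deg S ∧ superBracket k deg g f ∈ lieIdeal k deg S :=
  ⟨Submodule.mem_sInf.2 fun M hM => (hM.2 f (Submodule.mem_sInf.1 hf M hM) g hg).1,
    Submodule.mem_sInf.2 fun M hM => (hM.2 f (Submodule.mem_sInf.1 hf M hM) g hg).2⟩

theorem lieIdeal_le_freeLie (hS : ∀ s ∈ S, s ∈ freeLie k deg) :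
    lieIdeal k deg S ≤ freeLie k deg :=
  sInf_le ⟨hS, fun _ hp _ hq => ⟨superBracket_mem_freeLie hp hq, superBracket_mem_freeLie hq hp⟩⟩

theorem fill_mem_lieIdeal {s : MonoidAlgebra k (FreeMonoid X)} (hs : s ∈ S) (C : Context X) :
    C.fill k deg s ∈ lieIdeal k deg S := by
  induction C with
  | hole => exact subset_lieIdeal hs
  | mulRight C u ih => exact (superBracket_mem_lieIdeal ih (monomialEval_mem k deg u)).1
  | mulLeft u C ih => exact (superBracket_mem_lieIdeal ih (monomialEval_mem k deg u)).2

variable [LinearOrder X]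

/-- The same descent carried out within `freeLie`: a reduced leading word is removed by its
monomial, a nonreduced one by a relative bracket. -/
theorem congrLie_zero_of_mem [WellFoundedLT X] (h2 : (2 : k) ≠ 0)
    (hS : ∀ s ∈ S, s ∈ freeLie k deg)
    (hli : LinearIndependent k
      (fun u : {u : FreeMagma X // IsSuperLSMonomial deg u ∧ IsReduced S (rho u)} =>
        (Submodule.Quotient.mk ⟨monomialEval k deg u, monomialEval_mem k deg u⟩ :
          LieQuotient k deg S)))
    {w : FreeMonoid X} {f : MonoidAlgebra k (FreeMonoid X)} (hf : f ∈ lieIdeal k deg S)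
    (hfw : f ∈ supportedOn k {u | LenLexLT u w}) : CongrLie deg S w f 0 := by
  rw [CongrLie, sub_zero]
  set V : Submodule k (MonoidAlgebra k (FreeMonoid X)) := Submodule.span k
    {h | ∃ s ∈ S, ∃ C : Context X, h = C.fill k deg s ∧ ∀ u, h.coeff u ≠ 0 → LenLexLT u w}
    with hVdef
  have hV : V ≤ lieIdeal k deg S := by
    rw [hVdef, Submodule.span_le]
    rintro h ⟨s, hs, C, rfl, -⟩
    exact fill_mem_lieIdeal hs C
  let v : {u : FreeMagma X // IsSuperLSMonomial deg u ∧ IsReduced S (rho u)} → freeLie k deg :=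
    fun u => ⟨monomialEval k deg u, monomialEval_mem k deg u⟩
  have hfN : f ∈ V ⊔ (Submodule.span k (Set.range v)).map (freeLie k deg).subtype := by
    refine mem_of_forall_isLeadingWord (M := freeLie k deg) (fun f hf u hfu huw => ?_)
      (lieIdeal_le_freeLie hS hf) hfw
    obtain ⟨m, hm, rfl⟩ := exists_isSuperLSMonomial_of_isLeadingWord h2 hf hfu
    by_cases hu : IsReduced S (rho m)
    · exact ⟨monomialEval k deg m, monomialEval_mem k deg m, Submodule.mem_sup_right
        ⟨v ⟨m, hm, hu⟩, Submodule.subset_span ⟨_, rfl⟩, rfl⟩, hm.isLeadingWord h2⟩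
    · simp only [IsReduced, not_forall, not_not] at hu
      obtain ⟨s, hs, v, hv, a, b, hab⟩ := hu
      obtain ⟨n, hn, rfl⟩ := exists_isSuperLSMonomial_of_isLeadingWord h2 (hS s hs) hv
      obtain ⟨C, -, -, hC⟩ := hm.exists_context deg h2 hv hn.isLSOrSquare hab
      rw [← hab] at hC
      have hCI := fill_mem_lieIdeal (deg := deg) hs C
      refine ⟨C.fill k deg s, lieIdeal_le_freeLie hS hCI,
        Submodule.mem_sup_left (Submodule.subset_span ⟨s, hs, C, rfl, fun u hu => ?_⟩), hC⟩
      by_cases h : u = rho m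
      · exact h ▸ huw
      · exact (hC.2 u hu h).trans huw
  obtain ⟨x, hx, r, ⟨r, hr, rfl⟩, rfl⟩ := Submodule.mem_sup.1 hfN
  have hrI : (r : MonoidAlgebra k (FreeMonoid X)) ∈ lieIdeal k deg S := by
    have := sub_mem hf (hV hx)
    rwa [add_sub_cancel_left] at this
  -- The quotient map is defined only on `freeLie`, so independence is applied to the preimage r in
  -- that subspace.
  have hr0 : r = 0 := Submodule.disjoint_def.1 (Submodule.range_ker_disjoint (v := v)
    (f := ((lieIdeal k deg S).submoduleOf (freeLie k deg)).mkQ) hli) r hr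
    (by rw [Submodule.ker_mkQ]; exact hrI)
  rw [hr0, map_zero, add_zero]
  exact hx

/-- These properties are independent of the arrangement of brackets, which is why every choice of
relative brackets is covered. -/
theorem IsRelativeBracket.properties {a b v : FreeMonoid X}
    {p g : MonoidAlgebra k (FreeMonoid X)} (h : IsRelativeBracket deg a p b g) (hp : p ∈ S)
    (hv : IsLeadingWord p v) :
    g ∈ lieIdeal k deg S ∧ IsLeadingWord g (a * v * b) ∧ g.coeff (a * v * b) = 1 := by
  obtain ⟨v', C, hv', -, -, hC, rfl⟩ := h
  obtain rfl := hv.unique hv'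
  refine ⟨Submodule.smul_mem _ _ (fill_mem_lieIdeal hp C), hC.smul (inv_ne_zero hC.1), ?_⟩
  rw [MonoidAlgebra.coeff_smul_apply, smul_eq_mul, inv_mul_cancel₀ hC.1]

theorem closedLie_of_linearIndependent [WellFoundedLT X] (h2 : (2 : k) ≠ 0)
    (hS : ∀ s ∈ S, s ∈ freeLie k deg) (hmonic : ∀ s ∈ S, IsMonic s)
    (hli : LinearIndependent k
      (fun u : {u : FreeMagma X // IsSuperLSMonomial deg u ∧ IsReduced S (rho u)} =>
        (Submodule.Quotient.mk ⟨monomialEval k deg u, monomialEval_mem k deg u⟩ :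
          LieQuotient k deg S))) : ClosedLie deg S := by
  refine ⟨fun p hp q hq u v hu hv => ⟨fun a b hab _ g h hg hh => ?_, fun a b hab h hh => ?_⟩,
    fun p hp m hm hodd hpm => ?_⟩
  · obtain ⟨hgI, hg1, hg2⟩ := hg.properties hp hu
    obtain ⟨hhI, hh1, hh2⟩ := hh.properties hq hv
    rw [one_mul] at hg1 hg2
    rw [mul_one, ← hab] at hh1 hh2
    exact congrLie_zero_of_mem h2 hS hli (sub_mem hgI hhI)
      (hg1.sub_mem_supportedOn hh1 (hg2.trans hh2.symm))
  · obtain ⟨hhI, hh1, hh2⟩ := hh.properties hq hv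
    rw [← hab] at hh1 hh2
    exact congrLie_zero_of_mem h2 hS hli (sub_mem (subset_lieIdeal hp) hhI)
      (hu.sub_mem_supportedOn hh1 (by rw [hh2, (hmonic p hp).coeff_eq_one hu]))
  · refine congrLie_zero_of_mem h2 hS hli
      (superBracket_mem_lieIdeal (subset_lieIdeal hp) (monomialEval_mem k deg m)).1 ?_
    -- Both products of the leading words equal zzz, and zz is even, so the top terms of [p, [z]]
    -- cancel.
    have h := superBracket_sub_single_mem deg hpm (hm.isLeadingWord deg).1
      (Or.inr (mul_assoc _ _ _).symm)
    rw [superBracket_single, parity_mul, CharTwo.add_self_eq_zero, ← mul_assoc (rho m)] at h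
    simpa using h

end Lie

end SuperGS

theorem mainTheorem4 {k : Type*} [Field k] (h2 : ringChar k ≠ 2) (h3 : ringChar k ≠ 3)
    {X : Type*} [LinearOrder X] [WellFoundedLT X] (deg : X → ZMod 2)
    (S : Set (MonoidAlgebra k (FreeMonoid X)))
    (hS : ∀ s ∈ S, s ∈ SuperGS.freeLie k deg) (hmonic : ∀ s ∈ S, SuperGS.IsMonic s) :
    (SuperGS.IsLinearBasis k
        (fun u : {u : FreeMonoid X // SuperGS.IsReduced S u} =>
          ((MonoidAlgebra.single (u : FreeMonoid X) (1 : k) : MonoidAlgebra k (FreeMonoid X)) :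
            SuperGS.EnvelopingQuotient k S)) →
      SuperGS.ClosedAssoc S) ∧
    (SuperGS.IsLinearBasis k
        (fun u : {u : FreeMagma X // SuperGS.IsSuperLSMonomial deg u ∧
            SuperGS.IsReduced S (SuperGS.rho u)} =>
          (Submodule.Quotient.mk ⟨SuperGS.monomialEval k deg u, SuperGS.monomialEval_mem k deg u⟩ :
            SuperGS.LieQuotient k deg S)) →
      SuperGS.ClosedLie deg S) :=
  ⟨fun h => SuperGS.closedAssoc_of_linearIndependent hmonic h.1,
    fun h => SuperGS.closedLie_of_linearIndependent (Ring.two_ne_zero h2) hS hmonic h.1⟩
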